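/- Let $L$ be a non-degenerate even lattice, i.e. a free abelian group of finite rank with a non-degenerate symmetric bilinear form $\langle\cdot,\cdot\rangle:L\times L\to\mathbb{Z}$ (not necessarily definite) such that $\langle\alpha,\alpha\rangle\in 2\mathbb{Z}$ for all $\alpha\in L$. Put $\mathfrak{h}=\mathbb{C}\otimes_{\mathbb{Z}}L$, with the $\mathbb{C}$-bilinear extension of the form, and let $V_L=S(\widehat{\mathfrak h}_-)\otimes\mathbb{C}\{L\}$ with $\widehat{\mathfrak h}_-=\bigoplus_{n\ge1}\mathfrak h\otimes t^{-n}$ be the lattice vertex algebra. Here the twisted group algebra $\mathbb{C}\{L\}$ has basis $(e_\alpha)_{\alpha\in L}$ and product $e_\alpha e_\beta=\varepsilon(\alpha,\beta)e_{\alpha+\beta}$, where $\varepsilon:L\times L\to\{\pm1\}$ is any 2-cocycle with $\varepsilon(0,\alpha)=\varepsilon(\alpha,0)=1$ and $\varepsilon(\alpha,\beta)\varepsilon(\beta,\alpha)^{-1}=(-1)^{\langle\alpha,\beta\rangle}$; one writes $\iota(e_\alpha)=1\otimes e_\alpha$ and $\mathbf 1=\iota(e_0)$. The vertex operators are $$Y(\iota(e_\alpha),x)=\exp\Big(\sum_{n\ge1}\frac{\alpha(-n)}{n}x^{n}\Big)\exp\Big(-\sum_{n\ge1}\frac{\alpha(n)}{n}x^{-n}\Big)e_\alpha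 x^{\alpha},$$ where $x^\alpha e_\beta = x^{\langle\alpha,\beta\rangle}e_\beta$, and, with $h(x)=\sum_{j\in\mathbb Z}h(j)x^{-j-1}$, the operator $Y(h_1(-n_1)\cdots h_k(-n_k)\iota(e_\alpha),x)$ is the normal ordered product of the $\frac{1}{(n_i-1)!}\big(\frac{d}{dx}\big)^{n_i-1}h_i(x)$ and $Y(\iota(e_\alpha),x)$. Let $V_{L,\mathbb Z}$ be the vertex subring of $V_L$ generated by all $\iota(e_\alpha)$, $\alpha\in L$, i.e. the smallest additive subgroup of $V_L$ that contains $\mathbf 1$ and all $\iota(e_\alpha)$ and is closed under all products $u_nv$, $n\in\mathbb Z$, where $Y(u,x)v=\sum_n u_nv\,x^{-n-1}$. Let $$\omega=\frac12\sum_i\alpha_i(-1)\alpha_i'(-1)\mathbf 1,$$ where $(\alpha_i)$ is any basis of $\mathfrak h$ and $(\alpha_i')$ is its dual basis with respect to $\langle\cdot,\cdot\rangle$, be the conformal vector of $V_L$. Then $\omega\in V_{L,\mathbb Z}$ if and only if $L$ is self-dual, that is, $L=L^\circ$, where $L^\circ=\{x\in\mathfrak h:\langle x,\alpha\rangle\in\mathbb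 Z\text{ for all }\alpha\in L\}$. -/

import Mathlib

open scoped TensorProduct PowerSeries
open Module

noncomputable section

/-! ### Symmetric algebras: derivations and lifts to noncommutative algebras -/

namespace SymmetricAlgebra

section

variable {R M A : Type*} [CommSemiring R] [AddCommMonoid M] [Module R M] [Semiring A] [Algebra R A]

/-- A linear map with pairwise commuting values extends to an algebra homomorphism on the symmetric
algebra, also when the target algebra is not commutative. -/
def liftCommute (f : M →ₗ[R] A) (hf : ∀ x y, Commute (f x) (f y)) :
    SymmetricAlgebra R M →ₐ[R] A :=
  RingCon.liftₐ (TensorAlgebra.symRingCon R M) (TensorAlgebra.lift R f) <| by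
    refine RingCon.ringConGen_le.2 (fun x y h' => ?_)
    induction h' with | mul_comm x y
    rw [RingCon.ker_apply]
    simpa using (hf x y).eq

@[simp]
theorem liftCommute_ι (f : M →ₗ[R] A) (hf : ∀ x y, Commute (f x) (f y)) (x : M) :
    liftCommute f hf (ι R M x) = f x := by
  change TensorAlgebra.lift R f (TensorAlgebra.ι R x) = f x
  simp

end

variable {R M : Type*} [CommRing R] [AddCommGroup M] [Module R M]

/-- The algebra homomorphism `a ↦ a + ε D a` into the dual numbers, `D` being the derivation which
restricts to `f` on generators. -/
def derivHom (f : M →ₗ[R] SymmetricAlgebra R M) :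
    SymmetricAlgebra R M →ₐ[R]
      TrivSqZeroExt (SymmetricAlgebra R M) (SymmetricAlgebra R M) :=
  lift ((TrivSqZeroExt.inlAlgHom R (SymmetricAlgebra R M) (SymmetricAlgebra R M)).toLinearMap ∘ₗ
      ι R M + (TrivSqZeroExt.inrHom (SymmetricAlgebra R M) (SymmetricAlgebra R M)).restrictScalars R
        ∘ₗ f)

theorem fst_derivHom (f : M →ₗ[R] SymmetricAlgebra R M) (a : SymmetricAlgebra R M) :
    (derivHom f a).fst = a := by
  have : (TrivSqZeroExt.fstHom R (SymmetricAlgebra R M) (SymmetricAlgebra R M)).comp (derivHom f)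
      = AlgHom.id R _ := by
    ext x
    simp [derivHom]
  exact DFunLike.congr_fun this a

/-- The derivation of the symmetric algebra that restricts to `f` on generators. -/
def derivation (f : M →ₗ[R] SymmetricAlgebra R M) :
    Derivation R (SymmetricAlgebra R M) (SymmetricAlgebra R M) :=
  Derivation.mk'
    ((TrivSqZeroExt.sndHom (SymmetricAlgebra R M) (SymmetricAlgebra R M)).restrictScalars R ∘ₗ
      (derivHom f).toLinearMap) <| by
    intro a b
    simp [fst_derivHom, mul_comm]

@[simp]
theorem derivation_ι (f : M →ₗ[R] SymmetricAlgebra R M) (x : M) :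
    derivation f (ι R M x) = f x := by
  simp [derivation, derivHom]

theorem derivation_ext {D₁ D₂ : Derivation R (SymmetricAlgebra R M) (SymmetricAlgebra R M)}
    (h : ∀ x, D₁ (ι R M x) = D₂ (ι R M x)) : D₁ = D₂ := by
  ext a
  induction a using SymmetricAlgebra.induction with
  | algebraMap r => simp
  | ι x => exact h x
  | mul a b ha hb => simp [ha, hb]
  | add a b ha hb => simp [ha, hb]

end SymmetricAlgebra

/-- `exp f = ∑ r, f ^ r / r!` for a formal power series `f` with constant term `0` over a (possibly
noncommutative) algebra; the powers with `r > n` do not contribute to the coefficient of `x ^ n`. -/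
def formalExp {A : Type*} [Ring A] [Algebra ℂ A] (f : A⟦X⟧) : A⟦X⟧ :=
  PowerSeries.mk fun n =>
    ∑ r ∈ Finset.range (n + 1), ((r.factorial : ℂ)⁻¹) • PowerSeries.coeff n (f ^ r)

namespace LatticeVertex

variable {L : Type*} [AddCommGroup L]

/-! ### The lattice, its complexification and its dual -/

variable (L) in
/-- The space `𝔥 = ℂ ⊗ L`. -/
abbrev Cartan : Type _ := ℂ ⊗[ℤ] L

/-- The image `1 ⊗ α` of a lattice vector in `𝔥`. -/
abbrev toCartan (α : L) : Cartan L := (1 : ℂ) ⊗ₜ[ℤ] α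

/-- The `ℂ`-bilinear extension to `𝔥` of the form on `L`. -/
abbrev cform (B : LinearMap.BilinForm ℤ L) : LinearMap.BilinForm ℂ (Cartan L) :=
  B.baseChange ℂ

/-- The copy of `L` in `𝔥`. -/
def latticeIn (L : Type*) [AddCommGroup L] : Submodule ℤ (Cartan L) :=
  LinearMap.range (TensorProduct.mk ℤ ℂ L 1)

/-- `L` is self-dual: it coincides with `L° = {x ∈ 𝔥 | ⟨x, α⟩ ∈ ℤ for all α ∈ L}`. -/
def IsSelfDual (B : LinearMap.BilinForm ℤ L) : Prop :=
  (cform B).dualSubmodule (latticeIn L) = latticeIn L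

theorem cform_nondegenerate [Module.Free ℤ L] [Module.Finite ℤ L] {B : LinearMap.BilinForm ℤ L}
    (hB : B.Nondegenerate) : (cform B).Nondegenerate := by
  classical
  let b := Module.Free.chooseBasis ℤ L
  rw [LinearMap.BilinForm.nondegenerate_iff_det_ne_zero b] at hB
  rw [LinearMap.BilinForm.nondegenerate_iff_det_ne_zero (b.baseChange ℂ)]
  have : LinearMap.BilinForm.toMatrix (b.baseChange ℂ) (cform B)
      = (LinearMap.BilinForm.toMatrix b B).map (Int.castRingHom ℂ) := by
    ext i j
    simp [LinearMap.BilinForm.toMatrix_apply, LinearMap.BilinForm.baseChange_tmul]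
  rw [this, ← RingHom.mapMatrix_apply, ← RingHom.map_det]
  simpa using hB

/-- A normalized `2`-cocycle on `L` with values `±1` and commutator `(-1) ^ ⟨α, β⟩`. It describes
a central extension of `L` together with a section `α ↦ e_α`, `e_0 = 1`, through
`e_α e_β = ε(α, β) e_{α + β}` in the twisted group algebra `ℂ{L}`. -/
structure IsCocycle (B : LinearMap.BilinForm ℤ L) (ε : L → L → ℤˣ) : Prop where
  cocycle : ∀ α β γ, ε α β * ε (α + β) γ = ε β γ * ε α (β + γ)
  zero_left : ∀ α, ε 0 α = 1
  zero_right : ∀ α, ε α 0 = 1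
  commutator : ∀ α β, ε α β * (ε β α)⁻¹ = (-1) ^ (B α β)

/-! ### The Fock space `S(𝔥̂₋)` and the Heisenberg operators -/

variable (L) in
/-- The space `𝔥̂₋ = ⨁_{n ≥ 1} 𝔥 ⊗ t⁻ⁿ`; here `Finsupp.single k h` is `h ⊗ t^{-(k + 1)}`. -/
abbrev HeisMinus : Type _ := ℕ →₀ Cartan L

variable (L) in
/-- `S(𝔥̂₋)`. -/
abbrev Fock : Type _ := SymmetricAlgebra ℂ (HeisMinus L)

/-- The element `h(-(k + 1))` of `S(𝔥̂₋)`; as an operator `h(-(k + 1))` is multiplication by it. -/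
def creation (h : Cartan L) (k : ℕ) : Fock L :=
  SymmetricAlgebra.ι ℂ (HeisMinus L) (Finsupp.single k h)

variable (B : LinearMap.BilinForm ℤ L)

/-- For `n ≥ 1` the operator `h(n)` on `S(𝔥̂₋)`: the derivation with
`h(n) g(-m) = n ⟨h, g⟩ δ_{n,m}`. For `n = 0` this is the zero derivation. -/
def annihilation (h : Cartan L) (n : ℕ) : Derivation ℂ (Fock L) (Fock L) :=
  SymmetricAlgebra.derivation
    (Algebra.linearMap ℂ (Fock L) ∘ₗ ((n : ℂ) • (cform B h ∘ₗ Finsupp.lapply (n - 1))))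

theorem annihilation_ι (h : Cartan L) (n : ℕ) (g : HeisMinus L) :
    annihilation B h n (SymmetricAlgebra.ι ℂ (HeisMinus L) g)
      = algebraMap ℂ (Fock L) (n * cform B h (g (n - 1))) := by
  simp [annihilation]

theorem annihilation_add (h h' : Cartan L) (n : ℕ) :
    annihilation B (h + h') n = annihilation B h n + annihilation B h' n := by
  apply SymmetricAlgebra.derivation_ext
  intro x
  simp only [Derivation.add_apply, annihilation_ι, map_add, LinearMap.add_apply, mul_add]

theorem annihilation_smul (c : ℂ) (h : Cartan L) (n : ℕ) :
    annihilation B (c • h) n = c • annihilation B h n := by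
  apply SymmetricAlgebra.derivation_ext
  intro x
  simp only [Derivation.smul_apply, annihilation_ι, map_smul, LinearMap.smul_apply,
    Algebra.algebraMap_eq_smul_one, smul_smul, smul_eq_mul]
  congr 1
  ring

theorem annihilation_comm (h h' : Cartan L) (n n' : ℕ) (q : Fock L) :
    annihilation B h n (annihilation B h' n' q) = annihilation B h' n' (annihilation B h n q) := by
  induction q using SymmetricAlgebra.induction with
  | algebraMap r => simp
  | ι x => simp [annihilation_ι]
  | mul a b ha hb => simp [ha, hb]; ring
  | add a b ha hb => simp [ha, hb]

/-- The vectors killed by all products of annihilation operators of total degree more than `N`. -/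
def IsBounded (N : ℕ) (q : Fock L) : Prop :=
  ∀ l : List (Cartan L × ℕ), N < (l.map Prod.snd).sum →
    l.foldl (fun q a => annihilation B a.1 a.2 q) q = 0

variable {B}

theorem foldl_zero (l : List (Cartan L × ℕ)) :
    l.foldl (fun q a => annihilation B a.1 a.2 q) 0 = 0 := by
  induction l with
  | nil => rfl
  | cons a l ih => simpa using ih

theorem foldl_add (l : List (Cartan L × ℕ)) (p q : Fock L) :
    l.foldl (fun q a => annihilation B a.1 a.2 q) (p + q)
      = l.foldl (fun q a => annihilation B a.1 a.2 q) p
        + l.foldl (fun q a => annihilation B a.1 a.2 q) q := by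
  induction l generalizing p q with
  | nil => rfl
  | cons a l ih => simp [ih]

theorem foldl_const (l : List (Cartan L × ℕ)) (hl : 0 < (l.map Prod.snd).sum) (r : ℂ) :
    l.foldl (fun q a => annihilation B a.1 a.2 q) (algebraMap ℂ (Fock L) r) = 0 := by
  cases l with
  | nil => simp at hl
  | cons a l => simpa using foldl_zero l

namespace IsBounded

theorem mono {N N' : ℕ} (hN : N ≤ N') {q : Fock L} (hq : IsBounded B N q) : IsBounded B N' q :=
  fun l hl => hq l (lt_of_le_of_lt hN hl)

theorem annih {N : ℕ} {q : Fock L} (hq : IsBounded B N q) (h : Cartan L) (n : ℕ) :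
    IsBounded B (N - n) (annihilation B h n q) := by
  intro l hl
  exact hq ((h, n) :: l) (by simp; omega)

theorem annih_eq_zero {N : ℕ} {q : Fock L} (hq : IsBounded B N q) (h : Cartan L) {n : ℕ}
    (hn : N < n) : annihilation B h n q = 0 :=
  hq [(h, n)] (by simpa using hn)

theorem smul {N : ℕ} {q : Fock L} (hq : IsBounded B N q) (c : ℂ) : IsBounded B N (c • q) := by
  intro l hl
  have : ∀ (l : List (Cartan L × ℕ)) (q : Fock L),
      l.foldl (fun q a => annihilation B a.1 a.2 q) (c • q)
        = c • l.foldl (fun q a => annihilation B a.1 a.2 q) q := by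
    intro l
    induction l with
    | nil => intro q; rfl
    | cons a l ih => intro q; simp [ih]
  rw [this, hq l hl, smul_zero]

theorem foldl_mul (l : List (Cartan L × ℕ)) : ∀ {M N : ℕ} {p q : Fock L}, IsBounded B M p →
    IsBounded B N q → M + N < (l.map Prod.snd).sum →
    l.foldl (fun q a => annihilation B a.1 a.2 q) (p * q) = 0 := by
  induction l with
  | nil => intro M N p q _ _ h; simp at h
  | cons a l ih =>
    intro M N p q hp hq h
    simp only [List.map_cons, List.sum_cons] at h
    simp only [List.foldl_cons, Derivation.leibniz, smul_eq_mul]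
    rw [foldl_add]
    have h1 : l.foldl (fun q a => annihilation B a.1 a.2 q) (p * annihilation B a.1 a.2 q) = 0 := by
      by_cases hN : N < a.2
      · rw [hq.annih_eq_zero _ hN, mul_zero, foldl_zero]
      · exact ih hp (hq.annih a.1 a.2) (by omega)
    have h2 : l.foldl (fun q a => annihilation B a.1 a.2 q) (q * annihilation B a.1 a.2 p) = 0 := by
      by_cases hM : M < a.2
      · rw [hp.annih_eq_zero _ hM, mul_zero, foldl_zero]
      · exact ih hq (hp.annih a.1 a.2) (by omega)
    rw [h1, h2, add_zero]

end IsBounded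

variable (B) in
/-- Every vector of `S(𝔥̂₋)` is killed by all annihilation operators of high enough degree. -/
theorem exists_isBounded (q : Fock L) : ∃ N, IsBounded B N q := by
  induction q using SymmetricAlgebra.induction with
  | algebraMap r => exact ⟨0, fun l hl => foldl_const l hl r⟩
  | ι x =>
    refine ⟨x.support.sup id + 1, fun l hl => ?_⟩
    cases l with
    | nil => simp at hl
    | cons a l =>
      rw [List.foldl_cons, annihilation_ι]
      by_cases h0 : 0 < (l.map Prod.snd).sum
      · exact foldl_const l h0 _
      · simp only [List.map_cons, List.sum_cons] at hl
        have : x (a.2 - 1) = 0 := by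
          by_contra hx
          have := Finset.le_sup (f := id) (Finsupp.mem_support_iff.2 hx)
          simp only [id] at this
          omega
        simpa [this] using foldl_zero l
  | mul p q hp hq =>
    obtain ⟨M, hM⟩ := hp
    obtain ⟨N, hN⟩ := hq
    exact ⟨M + N, fun l hl => IsBounded.foldl_mul l hM hN hl⟩
  | add p q hp hq =>
    obtain ⟨M, hM⟩ := hp
    obtain ⟨N, hN⟩ := hq
    refine ⟨max M N, fun l hl => ?_⟩
    rw [foldl_add, hM l (lt_of_le_of_lt (le_max_left _ _) hl),
      hN l (lt_of_le_of_lt (le_max_right _ _) hl), add_zero]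

/-! ### The operators `E⁻(-α, x)` and `E⁺(-α, x)` -/

/-- `E⁻(-α, x) = exp (∑_{n ≥ 1} (α(-n) / n) xⁿ)`, a power series with coefficients in `S(𝔥̂₋)`
acting by multiplication. -/
def expMinus (α : L) : (Fock L)⟦X⟧ :=
  formalExp <| PowerSeries.mk fun n =>
    if n = 0 then 0 else ((n : ℂ)⁻¹) • creation (toCartan α) (n - 1)

variable (B)

/-- `E⁺(-α, x) = exp (-∑_{n ≥ 1} (α(n) / n) x⁻ⁿ)`, a power series in `x⁻¹` whose coefficients are
operators on `S(𝔥̂₋)`. -/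
def expPlus (α : L) : (Module.End ℂ (Fock L))⟦X⟧ :=
  formalExp <| PowerSeries.mk fun n =>
    if n = 0 then 0 else
      (-(n : ℂ)⁻¹) • (annihilation B (toCartan α) n : Fock L →ₗ[ℂ] Fock L)

variable {B}

theorem expPlus_coeff_eq_zero (α : L) {N n : ℕ} {q : Fock L} (hq : IsBounded B N q) (hn : N < n) :
    PowerSeries.coeff n (expPlus B α) q = 0 := by
  have key : ∀ (f : (Module.End ℂ (Fock L))⟦X⟧), (∀ j, ∃ c : ℂ, PowerSeries.coeff j f
      = c • (annihilation B (toCartan α) j : Fock L →ₗ[ℂ] Fock L)) →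
      ∀ (r N n : ℕ) (q : Fock L), IsBounded B N q → N < n → PowerSeries.coeff n (f ^ r) q = 0 := by
    intro f hf r
    induction r with
    | zero =>
      intro N n q _ hn
      rw [pow_zero, PowerSeries.coeff_one, if_neg (by omega)]
      rfl
    | succ r ih =>
      intro N n q hq hn
      rw [pow_succ, PowerSeries.coeff_mul, LinearMap.sum_apply]
      refine Finset.sum_eq_zero fun ij hij => ?_
      have hij := Finset.HasAntidiagonal.mem_antidiagonal.1 hij
      obtain ⟨c, hc⟩ := hf ij.2
      rw [Module.End.mul_apply, hc, LinearMap.smul_apply, map_smul]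
      by_cases h : N < ij.2
      · have := hq.annih_eq_zero (toCartan α) h
        rw [Derivation.coeFn_coe, this, map_zero, smul_zero]
      · rw [Derivation.coeFn_coe, ih (N - ij.2) ij.1 _ (hq.annih (toCartan α) ij.2) (by omega),
          smul_zero]
  rw [expPlus, formalExp, PowerSeries.coeff_mk, LinearMap.sum_apply]
  refine Finset.sum_eq_zero fun r _ => ?_
  rw [LinearMap.smul_apply, key _ _ r N n q hq hn, smul_zero]
  intro j
  rw [PowerSeries.coeff_mk]
  by_cases hj : j = 0
  · exact ⟨0, by simp [hj]⟩
  · exact ⟨-(j : ℂ)⁻¹, by simp [hj]⟩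

variable (L) in
/-- Linear maps `S(𝔥̂₋) → S(𝔥̂₋)((x))`. -/
abbrev Field : Type _ := Fock L →ₗ[ℂ] LaurentSeries (Fock L)

variable (L) in
/-- The monomial `xᵏ` in `S(𝔥̂₋)((x))`. -/
abbrev xpow (k : ℤ) : LaurentSeries (Fock L) := HahnSeries.single k (1 : Fock L)

theorem laurent_mul_smul (c : ℂ) (a b : LaurentSeries (Fock L)) : a * c • b = c • (a * b) := by
  have h : ∀ b : LaurentSeries (Fock L), c • b = HahnSeries.C (algebraMap ℂ (Fock L) c) * b := by
    intro b
    ext k : 2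
    rw [HahnSeries.coeff_smul, HahnSeries.C_mul_eq_smul, HahnSeries.coeff_smul, smul_eq_mul,
      Algebra.smul_def]
  rw [h, h, mul_left_comm]

/-- Multiplication by `a` on `S(𝔥̂₋)((x))`. -/
def laurentMul (a : LaurentSeries (Fock L)) :
    LaurentSeries (Fock L) →ₗ[ℂ] LaurentSeries (Fock L) where
  toFun b := a * b
  map_add' := mul_add a
  map_smul' c b := laurent_mul_smul c a b

@[simp]
theorem laurentMul_apply (a b : LaurentSeries (Fock L)) : laurentMul a b = a * b := rfl

variable (B)

/-- `E⁺(-α, x)` as a map `S(𝔥̂₋) → S(𝔥̂₋)((x))`. -/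
def expPlusField (α : L) : Field L where
  toFun q := HahnSeries.ofSuppBddBelow
    (fun k : ℤ => if k ≤ 0 then PowerSeries.coeff (-k).toNat (expPlus B α) q else 0) <| by
      obtain ⟨N, hN⟩ := exists_isBounded B q
      refine ⟨-(N : ℤ), fun k hk => ?_⟩
      by_contra h
      apply hk
      dsimp only
      rw [if_pos (by omega)]
      exact expPlus_coeff_eq_zero α hN (by omega)
  map_add' p q := by
    ext k
    by_cases h : k ≤ 0 <;> simp [h]
  map_smul' c q := by
    ext k
    by_cases h : k ≤ 0 <;> simp [h]

/-- The vertex operator `Y(ι(e_α), x) = E⁻(-α, x) E⁺(-α, x) e_α x^α` on the summand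
`S(𝔥̂₋) ⊗ e_β`, up to the factor `e_α : e_β ↦ ε(α, β) e_{α + β}`. -/
def expField (α β : L) : Field L :=
  laurentMul (xpow L (B α β) * HahnSeries.ofPowerSeries ℤ (Fock L) (expMinus α)) ∘ₗ
    expPlusField B α

/-! ### Normal ordered products -/

/-- The operator `h(j)`, `j ≥ 0`, on the summand `S(𝔥̂₋) ⊗ e_β`. -/
def mode (β : L) (h : Cartan L) (j : ℕ) : Module.End ℂ (Fock L) :=
  if j = 0 then cform B h (toCartan β) • LinearMap.id else annihilation B h j

variable {B}

theorem mode_add (β : L) (h h' : Cartan L) (j : ℕ) :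
    mode B β (h + h') j = mode B β h j + mode B β h' j := by
  by_cases hj : j = 0
  · simp only [mode, if_pos hj, map_add, LinearMap.add_apply, add_smul]
  · simp only [mode, if_neg hj, annihilation_add]
    rfl

theorem mode_smul (β : L) (c : ℂ) (h : Cartan L) (j : ℕ) :
    mode B β (c • h) j = c • mode B β h j := by
  by_cases hj : j = 0
  · simp only [mode, if_pos hj, map_smul, LinearMap.smul_apply, smul_smul, smul_eq_mul]
  · simp only [mode, if_neg hj, annihilation_smul]
    rfl

theorem mode_comm (β : L) (h h' : Cartan L) (j j' : ℕ) (q : Fock L) :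
    mode B β h j (mode B β h' j' q) = mode B β h' j' (mode B β h j q) := by
  by_cases hj : j = 0 <;> by_cases hj' : j' = 0 <;>
    simp [mode, hj, hj', annihilation_comm B h h', smul_smul, mul_comm]

theorem IsBounded.mode {N : ℕ} {q : Fock L} (hq : IsBounded B N q) (β : L) (h : Cartan L) (j : ℕ) :
    IsBounded B N (mode B β h j q) := by
  by_cases hj : j = 0
  · simpa only [LatticeVertex.mode, if_pos hj, LinearMap.smul_apply, LinearMap.id_apply] using
      hq.smul _
  · simpa only [LatticeVertex.mode, if_neg hj, Derivation.coeFn_coe] using (hq.annih h j).mono (Nat.sub_le N j)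

theorem IsBounded.mode_eq_zero {N : ℕ} {q : Fock L} (hq : IsBounded B N q) (β : L) (h : Cartan L)
    {j : ℕ} (hj : N < j) : LatticeVertex.mode B β h j q = 0 := by
  rw [LatticeVertex.mode, if_neg (by omega)]
  exact hq.annih_eq_zero h hj

/-- For `h(x) = ∑_{j ∈ ℤ} h(j) x^{-j-1}`, the part of `(1 / n!) (d/dx)ⁿ h(x)` containing the
operators `h(j)` with `j < 0`. It is `∑_{k ≥ 0} (k + n choose n) h(-(k + n + 1)) xᵏ`. -/
def currentMinus (h : Cartan L) (n : ℕ) : (Fock L)⟦X⟧ :=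
  PowerSeries.mk fun k => ((k + n).choose n : ℂ) • creation h (k + n)

/-- The map `X ↦ h₋ X`, where `h₋ = currentMinus h n`. -/
def leftMul (h : Cartan L) (n : ℕ) : Module.End ℂ (Field L) where
  toFun X := laurentMul (HahnSeries.ofPowerSeries ℤ (Fock L) (currentMinus h n)) ∘ₗ X
  map_add' X X' := by ext q : 1; simp [mul_add]
  map_smul' c X := by ext q : 1; simp

variable (B) in
/-- The term of `X ∘ h₊` containing `h(j)`, where `h₊` is the part
`∑_{j ≥ 0} (-1)ⁿ (j + n choose n) h(j) x^{-j-n-1}` of `(1 / n!) (d/dx)ⁿ h(x)` containing the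
operators `h(j)` with `j ≥ 0`. -/
def rightTerm (β : L) (h : Cartan L) (n j : ℕ) (X : Field L) (q : Fock L) :
    LaurentSeries (Fock L) :=
  ((-1) ^ n * ((j + n).choose n : ℂ)) • (xpow L (-j - n - 1) * X (mode B β h j q))

theorem finsum_rightTerm (β : L) (h : Cartan L) (n : ℕ) (X : Field L) {N : ℕ} {q : Fock L}
    (hq : IsBounded B N q) :
    ∑ᶠ j, rightTerm B β h n j X q = ∑ j ∈ Finset.range (N + 1), rightTerm B β h n j X q := by
  apply finsum_eq_sum_of_support_subset
  intro j hj
  by_contra h'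
  apply hj
  simp only [Finset.coe_range, Set.mem_Iio] at h'
  simp [rightTerm, hq.mode_eq_zero β h (show N < j by omega)]

variable (B) in
/-- The map `X ↦ X ∘ h₊` for fields `X` on the summand `S(𝔥̂₋) ⊗ e_β`. For each vector only finitely
many terms are nonzero. -/
def rightMul (β : L) (h : Cartan L) (n : ℕ) : Module.End ℂ (Field L) where
  toFun X :=
    { toFun := fun q => ∑ᶠ j, rightTerm B β h n j X q
      map_add' := fun p q => by
        obtain ⟨M, hM⟩ := exists_isBounded B p
        obtain ⟨N, hN⟩ := exists_isBounded B q
        obtain ⟨K, hK⟩ := exists_isBounded B (p + q)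
        rw [finsum_rightTerm β h n X (hM.mono (show M ≤ M + N + K by omega)),
          finsum_rightTerm β h n X (hN.mono (show N ≤ M + N + K by omega)),
          finsum_rightTerm β h n X (hK.mono (show K ≤ M + N + K by omega)),
          ← Finset.sum_add_distrib]
        simp [rightTerm, mul_add]
      map_smul' := fun c q => by
        obtain ⟨N, hN⟩ := exists_isBounded B q
        rw [finsum_rightTerm β h n X hN, finsum_rightTerm β h n X (hN.smul c), Finset.smul_sum]
        refine Finset.sum_congr rfl fun j _ => ?_
        simp only [rightTerm, map_smul, RingHom.id_apply, laurent_mul_smul]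
        rw [smul_comm] }
  map_add' X X' := by
    ext q : 1
    obtain ⟨N, hN⟩ := exists_isBounded B q
    change ∑ᶠ j, rightTerm B β h n j (X + X') q
      = (∑ᶠ j, rightTerm B β h n j X q) + ∑ᶠ j, rightTerm B β h n j X' q
    rw [finsum_rightTerm β h n _ hN, finsum_rightTerm β h n _ hN, finsum_rightTerm β h n _ hN,
      ← Finset.sum_add_distrib]
    simp [rightTerm, mul_add]
  map_smul' c X := by
    ext q : 1
    obtain ⟨N, hN⟩ := exists_isBounded B q
    change ∑ᶠ j, rightTerm B β h n j (c • X) q = c • (∑ᶠ j, rightTerm B β h n j X q)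
    rw [finsum_rightTerm β h n _ hN, finsum_rightTerm β h n _ hN, Finset.smul_sum]
    refine Finset.sum_congr rfl fun j _ => ?_
    simp only [rightTerm, LinearMap.smul_apply, laurent_mul_smul]
    rw [smul_comm]

theorem rightMul_apply (β : L) (h : Cartan L) (n : ℕ) (X : Field L) {N : ℕ} {q : Fock L}
    (hq : IsBounded B N q) :
    rightMul B β h n X q = ∑ j ∈ Finset.range (N + 1), rightTerm B β h n j X q :=
  finsum_rightTerm β h n X hq

variable (B) in
/-- The map `X ↦ h₋ X + X h₊`, that is, the normal ordered product of `X` with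
`(1 / n!) (d/dx)ⁿ h(x) = Y(h(-n-1)𝟏, x)`. -/
def normalMul (β : L) (n : ℕ) : Cartan L →ₗ[ℂ] Module.End ℂ (Field L) where
  toFun h := leftMul h n + rightMul B β h n
  map_add' h h' := by
    ext X q : 2
    obtain ⟨N, hN⟩ := exists_isBounded B q
    have : currentMinus (h + h') n = currentMinus h n + currentMinus h' n := by
      ext k : 1
      simp [currentMinus, creation]
    simp only [LinearMap.add_apply, leftMul, LinearMap.coe_mk, AddHom.coe_mk, LinearMap.comp_apply,
      laurentMul_apply, this, map_add, add_mul, rightMul_apply _ _ _ _ hN, rightTerm,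
      mode_add, mul_add, smul_add, Finset.sum_add_distrib]
    abel
  map_smul' c h := by
    ext X q : 2
    obtain ⟨N, hN⟩ := exists_isBounded B q
    have : HahnSeries.ofPowerSeries ℤ (Fock L) (currentMinus (c • h) n)
        = c • HahnSeries.ofPowerSeries ℤ (Fock L) (currentMinus h n) := by
      have : currentMinus (c • h) n
          = PowerSeries.C (algebraMap ℂ (Fock L) c) * currentMinus h n := by
        ext k : 1
        rw [PowerSeries.coeff_C_mul, ← Algebra.smul_def]
        simp only [currentMinus, creation, PowerSeries.coeff_mk, ← Finsupp.smul_single, map_smul]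
        rw [smul_comm]
      rw [this, map_mul, HahnSeries.ofPowerSeries_C]
      ext k : 2
      rw [HahnSeries.C_mul_eq_smul, HahnSeries.coeff_smul, HahnSeries.coeff_smul, smul_eq_mul,
        Algebra.smul_def]
    simp only [LinearMap.add_apply, leftMul, LinearMap.coe_mk, AddHom.coe_mk, LinearMap.comp_apply,
      laurentMul_apply, this, rightMul_apply _ _ _ _ hN, rightTerm, RingHom.id_apply,
      mode_smul, LinearMap.smul_apply, map_smul, smul_add, Finset.smul_sum, laurent_mul_smul]
    congr 1
    · rw [mul_comm, laurent_mul_smul, mul_comm]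
    · refine Finset.sum_congr rfl fun j _ => ?_
      rw [smul_comm]

theorem normalMul_comm (β : L) (n n' : ℕ) (h h' : Cartan L) :
    Commute (normalMul B β n h) (normalMul B β n' h') := by
  have hLL : ∀ n n' (h h' : Cartan L), Commute (leftMul h n) (leftMul h' n') := by
    intro n n' h h'
    ext X q : 2
    simp only [Module.End.mul_apply, leftMul, LinearMap.coe_mk, AddHom.coe_mk,
      LinearMap.comp_apply, laurentMul_apply]
    ring
  have hLR : ∀ n n' (h h' : Cartan L), Commute (leftMul h n) (rightMul B β h' n') := by
    intro n n' h h'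
    ext X q : 2
    obtain ⟨N, hN⟩ := exists_isBounded B q
    rw [Module.End.mul_apply, Module.End.mul_apply, rightMul_apply _ _ _ _ hN]
    simp only [leftMul, LinearMap.coe_mk, AddHom.coe_mk,
      LinearMap.comp_apply, laurentMul_apply, rightMul_apply _ _ _ _ hN, rightTerm,
      Finset.mul_sum, laurent_mul_smul]
    refine Finset.sum_congr rfl fun j _ => ?_
    rw [mul_left_comm]
  have hRR : Commute (rightMul B β h n) (rightMul B β h' n') := by
    ext X q : 2
    obtain ⟨N, hN⟩ := exists_isBounded B q
    rw [Module.End.mul_apply, Module.End.mul_apply, rightMul_apply _ _ _ _ hN,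
      rightMul_apply _ _ _ _ hN]
    simp only [rightTerm, rightMul_apply _ _ _ _ (hN.mode β _ _), Finset.mul_sum, Finset.smul_sum]
    rw [Finset.sum_comm]
    refine Finset.sum_congr rfl fun j _ => Finset.sum_congr rfl fun i _ => ?_
    rw [mode_comm β h' h, laurent_mul_smul, laurent_mul_smul, smul_comm, mul_left_comm]
  exact ((hLL _ _ _ _).add_right (hLR _ _ _ _)).add_left
    (((hLR _ _ _ _).symm).add_right hRR)

variable (B) in
/-- The `ℂ`-linear extension to `𝔥̂₋` of `h(-n-1) ↦ (X ↦ h₋ X + X h₊)`. -/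
def heisNormalMul (β : L) : HeisMinus L →ₗ[ℂ] Module.End ℂ (Field L) :=
  Finsupp.lsum ℂ (normalMul B β)

theorem heisNormalMul_comm (β : L) (x y : HeisMinus L) :
    Commute (heisNormalMul B β x) (heisNormalMul B β y) := by
  rw [heisNormalMul, Finsupp.lsum_apply, Finsupp.lsum_apply]
  exact Commute.sum_left _ _ _ fun i _ => Commute.sum_right _ _ _ fun j _ =>
    normalMul_comm β i j _ _

variable (B) in
/-- Iterated normal ordered products: a monomial `h₁(-n₁-1) ⋯ h_k(-n_k-1)` sends `X` to
`: ∏ᵢ (1 / nᵢ!) (d/dx)^{nᵢ} hᵢ(x)  X :`. -/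
def normalOrder (β : L) : Fock L →ₐ[ℂ] Module.End ℂ (Field L) :=
  SymmetricAlgebra.liftCommute (heisNormalMul B β) (heisNormalMul_comm β)

/-! ### The lattice vertex algebra -/

variable (L) in
/-- `V_L = S(𝔥̂₋) ⊗ ℂ{L}`; here `Finsupp.single α p` is `p ⊗ e_α`. -/
abbrev VL : Type _ := L →₀ Fock L

/-- The vectors `ι(e_α) = 1 ⊗ e_α`. -/
def expVector (α : L) : VL L := Finsupp.single α 1

variable (L) in
/-- The vacuum vector `𝟏 = ι(e_0)`. -/
def vacuum : VL L := expVector 0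

variable (B) in
/-- The product `u_n v` of `V_L`: the coefficient of `x^{-n-1}` in `Y(u, x) v`, where for
`u = h₁(-n₁-1) ⋯ h_k(-n_k-1) ι(e_α)`
`Y(u, x) = : ∏ᵢ (1 / nᵢ!) (d/dx)^{nᵢ} hᵢ(x)  Y(ι(e_α), x) :`. -/
def nthProduct (ε : L → L → ℤˣ) (n : ℤ) (u v : VL L) : VL L :=
  u.sum fun α p => v.sum fun β q =>
    Finsupp.single (α + β) (((ε α β : ℤ) : ℂ) •
      (normalOrder B β p (expField B α β) q).coeff (-n - 1))

variable (B) in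
/-- Vertex subrings of `V_L`: additive subgroups that contain `𝟏` and are closed under all products
`u_n v`, `n ∈ ℤ`. -/
structure IsVertexSubring (ε : L → L → ℤˣ) (W : AddSubgroup (VL L)) : Prop where
  vacuum_mem : vacuum L ∈ W
  nthProduct_mem : ∀ (n : ℤ) {u v : VL L}, u ∈ W → v ∈ W → nthProduct B ε n u v ∈ W

variable (B) in
/-- `V_{L,ℤ}`: the vertex subring of `V_L` generated by the `ι(e_α)`, `α ∈ L`. -/
def integralForm (ε : L → L → ℤˣ) : AddSubgroup (VL L) :=
  sInf {W | IsVertexSubring B ε W ∧ ∀ α, expVector α ∈ W}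

/-- The conformal vector `ω = (1/2) ∑ᵢ αᵢ(-1) αᵢ'(-1) 𝟏`, where `(αᵢ)` is a basis of `𝔥` and `(αᵢ')`
the dual basis. -/
def conformalVector [Module.Free ℤ L] [Module.Finite ℤ L] (hB : B.Nondegenerate)
    {ι : Type*} [Fintype ι] [DecidableEq ι] (b : Basis ι ℂ (Cartan L)) : VL L :=
  Finsupp.single 0 ((2⁻¹ : ℂ) • ∑ i, creation (b i) 0 *
    creation ((cform B).dualBasis (cform_nondegenerate hB) b i) 0)

end LatticeVertex

end

open Finset.HasAntidiagonal

/-! ### Formal exponentials -/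

section FormalExp

variable {A : Type*} [Ring A]

/-! Write `s_γ(n)` for the coefficient of `yⁿ` in `E⁻(-γ, y)` (`schur γ n`), and let `A` be the
subring of `S(𝔥̂₋)` generated by all `s_γ(n)` (`integralFock`).

If `ω ∈ V_{L,ℤ}`: all components of vectors in `V_{L,ℤ}` lie in `A`
(`integralForm_le_integralVectors`). For `x, y ∈ L°` the derivations `x(1)`, `y(1)` preserve `A`,
since they multiply `E⁻(-γ, y)` by integer multiples of the formal variable (`annihilation_schur`,
`annihilation_mem`). As `x(1) y(1) ω = ⟨x, y⟩ 𝟏` and the only constants in `A` are integers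
(`exists_int_of_algebraMap_mem`), the form is integral on `L°`, which forces `L° = L`.

If `L = L°`: for a `ℤ`-basis `(a_k)` of `L` the dual basis `(δ_k)` lies in `L`, and `ω = ½ ∑ ⟨δ_k,
δ_l⟩ a_k(-1) a_l(-1) 𝟏`. Off-diagonal terms pair up and the diagonal coefficients are even, so the
half disappears; each `a_k(-1) a_l(-1) 𝟏` is in `V_{L,ℤ}` (`single_creation_mul_creation_mem`).

The main work is that `A ⊗ ℂ{L}` bounds `V_{L,ℤ}`: products `u_n v` must keep components in `A`. Two
formulas carry this. First, `E⁺(-α, x) E⁻(-γ, y) = (1 - y/x)^{⟨α,γ⟩} E⁻(-γ, y) E⁺(-α, x)`, so the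
coefficients of `E⁺` preserve `A` (`coeff_expPlus_schur`, `coeff_expPlus_mul`). Second, normal
ordering `E⁻(-γ, y)` with a field `X(x)` gives `E⁻(-γ, x+y) E⁻(-γ, x)⁻¹ X(x) (1 + y/x)^{⟨γ,β⟩}
E⁺(-γ, x+y) E⁺(-γ, x)⁻¹` on the summand of `e_β`; Taylor coefficients in `y` are divided
derivatives, which involve only integral binomials (`normalOrder_schur_apply`). Such identities are
proved coefficientwise: both sides satisfy the same first-order differential equation, that is, a
recursion for `n + 1` times the coefficient of index `n + 1`. -/

theorem PowerSeries.coeff_pow_eq_zero_of_lt {f : A⟦X⟧} (hf : coeff 0 f = 0) (r : ℕ) :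
    ∀ n < r, coeff n (f ^ r) = 0 := by
  induction r with
  | zero => intro n hn; omega
  | succ r ih =>
    intro n hn
    rw [pow_succ, coeff_mul]
    refine Finset.sum_eq_zero fun ij hij => ?_
    have hij := mem_antidiagonal.1 hij
    rcases Nat.eq_zero_or_pos ij.2 with h | h
    · rw [h, hf, mul_zero]
    · rw [ih ij.1 (by omega), zero_mul]

theorem commute_coeff_pow {a : A} {f : A⟦X⟧} (h : ∀ i, Commute a (PowerSeries.coeff i f))
    (r n : ℕ) : Commute a (PowerSeries.coeff n (f ^ r)) := by
  induction r generalizing n with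
  | zero =>
    rw [pow_zero, PowerSeries.coeff_one]
    split_ifs
    · exact Commute.one_right a
    · exact Commute.zero_right a
  | succ r ih =>
    rw [pow_succ, PowerSeries.coeff_mul]
    exact Commute.sum_right _ _ _ fun ij _ => (ih _).mul_right (h _)

variable [Algebra ℂ A]

theorem coeff_formalExp_of_lt {f : A⟦X⟧} (hf : PowerSeries.coeff 0 f = 0) {n N : ℕ} (h : n < N) :
    PowerSeries.coeff n (formalExp f) =
      ∑ r ∈ Finset.range N, ((r.factorial : ℂ)⁻¹) • PowerSeries.coeff n (f ^ r) := by
  rw [formalExp, PowerSeries.coeff_mk]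
  refine Finset.sum_subset (fun x hx => ?_) fun r _ hr => ?_
  · simp only [Finset.mem_range] at *; omega
  · rw [PowerSeries.coeff_pow_eq_zero_of_lt hf r n (by simpa using hr), smul_zero]

theorem coeff_zero_formalExp (f : A⟦X⟧) : PowerSeries.coeff 0 (formalExp f) = 1 := by
  simp [formalExp]

theorem commute_coeff_formalExp {a : A} {f : A⟦X⟧} (h : ∀ i, Commute a (PowerSeries.coeff i f))
    (n : ℕ) : Commute a (PowerSeries.coeff n (formalExp f)) := by
  rw [formalExp, PowerSeries.coeff_mk]
  exact Commute.sum_right _ _ _ fun r _ => (commute_coeff_pow h r n).smul_right _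

theorem smul_sum_antidiagonal_mul (n : ℕ) (u v : ℕ → A) :
    (n : ℂ) • ∑ ij ∈ antidiagonal n, u ij.1 * v ij.2 =
      ∑ ij ∈ antidiagonal n, (((ij.1 : ℂ) • u ij.1) * v ij.2 + u ij.1 * ((ij.2 : ℂ) • v ij.2)) := by
  rw [Finset.smul_sum]
  refine Finset.sum_congr rfl fun ij hij => ?_
  rw [← mem_antidiagonal.1 hij, Nat.cast_add, add_smul, smul_mul_assoc, mul_smul_comm]

/-- The Euler operator `x d/dx` applied to a power of a series with commuting coefficients. -/
theorem euler_coeff_pow {f : A⟦X⟧}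
    (hf : ∀ i j, Commute (PowerSeries.coeff i f) (PowerSeries.coeff j f)) (r n : ℕ) :
    (n : ℂ) • PowerSeries.coeff n (f ^ (r + 1)) = ((r + 1 : ℕ) : ℂ) •
      ∑ ij ∈ antidiagonal n,
        ((ij.1 : ℂ) • PowerSeries.coeff ij.1 f) * PowerSeries.coeff ij.2 (f ^ r) := by
  set D : A⟦X⟧ := PowerSeries.mk fun n => (n : ℂ) • PowerSeries.coeff n f with hD
  have hfD : f * D = D * f := by
    ext n
    rw [PowerSeries.coeff_mul, PowerSeries.coeff_mul, ← Finset.Nat.sum_antidiagonal_swap]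
    refine Finset.sum_congr rfl fun ij _ => ?_
    simp only [hD, PowerSeries.coeff_mk, Prod.fst_swap, Prod.snd_swap]
    exact ((hf _ _).smul_right _).eq
  have key : ∀ r n : ℕ, (n : ℂ) • PowerSeries.coeff n (f ^ (r + 1)) =
      ((r + 1 : ℕ) : ℂ) • PowerSeries.coeff n (D * f ^ r) := by
    intro r
    induction r with
    | zero => intro n; simp [hD]
    | succ r ih =>
      intro n
      rw [pow_succ, PowerSeries.coeff_mul,
        smul_sum_antidiagonal_mul n (fun i => PowerSeries.coeff i (f ^ (r + 1)))
          (fun j => PowerSeries.coeff j f), Finset.sum_add_distrib]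
      have h1 : ∑ ij ∈ antidiagonal n, ((ij.1 : ℂ) • PowerSeries.coeff ij.1 (f ^ (r + 1))) *
          PowerSeries.coeff ij.2 f =
          ((r + 1 : ℕ) : ℂ) • PowerSeries.coeff n (D * f ^ (r + 1)) := by
        rw [show D * f ^ (r + 1) = D * f ^ r * f by rw [pow_succ, mul_assoc], PowerSeries.coeff_mul,
          Finset.smul_sum]
        exact Finset.sum_congr rfl fun ij _ => by rw [ih, smul_mul_assoc]
      -- The derivative of the last factor arises on the right; commutativity of the coefficients
      -- moves it to the left.
      have h2 : ∑ ij ∈ antidiagonal n, PowerSeries.coeff ij.1 (f ^ (r + 1)) *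
          ((ij.2 : ℂ) • PowerSeries.coeff ij.2 f) = PowerSeries.coeff n (D * f ^ (r + 1)) := by
        rw [← ((show Commute f D from hfD).pow_left (r + 1)).eq, PowerSeries.coeff_mul]
        exact Finset.sum_congr rfl fun ij _ => by rw [hD, PowerSeries.coeff_mk]
      rw [h1, h2, Nat.cast_succ (r + 1), add_smul, one_smul]
  rw [key, PowerSeries.coeff_mul]
  simp [hD]

theorem euler_coeff_formalExp {f : A⟦X⟧} (hf0 : PowerSeries.coeff 0 f = 0)
    (hf : ∀ i j, Commute (PowerSeries.coeff i f) (PowerSeries.coeff j f)) (n : ℕ) :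
    (n : ℂ) • PowerSeries.coeff n (formalExp f) = ∑ ij ∈ antidiagonal n,
      ((ij.1 : ℂ) • PowerSeries.coeff ij.1 f) * PowerSeries.coeff ij.2 (formalExp f) := by
  have h : ∀ ij ∈ antidiagonal n,
      ((ij.1 : ℂ) • PowerSeries.coeff ij.1 f) * PowerSeries.coeff ij.2 (formalExp f) =
      ∑ r ∈ Finset.range (n + 1), ((r.factorial : ℂ)⁻¹) •
        (((ij.1 : ℂ) • PowerSeries.coeff ij.1 f) * PowerSeries.coeff ij.2 (f ^ r)) := by
    intro ij hij
    have hij := mem_antidiagonal.1 hij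
    rw [coeff_formalExp_of_lt hf0 (show ij.2 < n + 1 by omega), Finset.mul_sum]
    exact Finset.sum_congr rfl fun r _ => by rw [mul_smul_comm]
  -- One superfluous term is kept: once the term `r = 0` is split off, the shifted sum has the same
  -- range as the right side.
  rw [Finset.sum_congr rfl h, Finset.sum_comm, coeff_formalExp_of_lt hf0 (show n < n + 2 by omega),
    Finset.sum_range_succ', smul_add, Finset.smul_sum]
  have h0 : (n : ℂ) • ((Nat.factorial 0 : ℂ)⁻¹) • PowerSeries.coeff n (f ^ 0) = 0 := by
    rw [pow_zero, PowerSeries.coeff_one]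
    split_ifs with h
    · simp [h]
    · simp
  rw [h0, add_zero]
  refine Finset.sum_congr rfl fun r _ => ?_
  rw [smul_comm, euler_coeff_pow hf, smul_smul, ← Finset.smul_sum, Nat.factorial_succ]
  congr 1
  have : ((r + 1 : ℕ) : ℂ) ≠ 0 := Nat.cast_ne_zero.2 (by omega)
  have : (r.factorial : ℂ) ≠ 0 := Nat.cast_ne_zero.2 r.factorial_ne_zero
  push_cast at *
  field_simp

/-- `exp f` is determined by `(d/dx) exp f = (df/dx) exp f`. -/
theorem succ_smul_coeff_formalExp {f : A⟦X⟧} (hf0 : PowerSeries.coeff 0 f = 0)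
    (hf : ∀ i j, Commute (PowerSeries.coeff i f) (PowerSeries.coeff j f)) (n : ℕ) :
    ((n + 1 : ℕ) : ℂ) • PowerSeries.coeff (n + 1) (formalExp f) = ∑ ij ∈ antidiagonal n,
      (((ij.1 + 1 : ℕ) : ℂ) • PowerSeries.coeff (ij.1 + 1) f) *
        PowerSeries.coeff ij.2 (formalExp f) := by
  rw [euler_coeff_formalExp hf0 hf, Finset.Nat.antidiagonal_succ]
  simp

theorem eq_of_smul_eq {V : Type*} [AddCommGroup V] [Module ℂ V] {n : ℕ} (hn : n ≠ 0) {x y : V}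
    (h : (n : ℂ) • x = (n : ℂ) • y) : x = y :=
  smul_right_injective V (Nat.cast_ne_zero.2 hn : (n : ℂ) ≠ 0) h

/-- The Euler operator kills the product, because the logarithmic derivatives `D` and `-D` cancel
after `D` is moved past `exp f`; the constant term is `1`. -/
theorem formalExp_mul_formalExp_neg {f : A⟦X⟧} (hf0 : PowerSeries.coeff 0 f = 0)
    (hf : ∀ i j, Commute (PowerSeries.coeff i f) (PowerSeries.coeff j f)) :
    formalExp f * formalExp (-f) = 1 := by
  have hg0 : PowerSeries.coeff 0 (-f) = 0 := by rw [map_neg, hf0, neg_zero]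
  have hg : ∀ i j, Commute (PowerSeries.coeff i (-f)) (PowerSeries.coeff j (-f)) := by
    intro i j; simpa using hf i j
  set D : A⟦X⟧ := PowerSeries.mk fun n => (n : ℂ) • PowerSeries.coeff n f with hD
  have e1 : ∀ n : ℕ, (n : ℂ) • PowerSeries.coeff n (formalExp f) =
      PowerSeries.coeff n (D * formalExp f) := by
    intro n
    rw [euler_coeff_formalExp hf0 hf, PowerSeries.coeff_mul]
    simp [hD]
  have e2 : ∀ n : ℕ, (n : ℂ) • PowerSeries.coeff n (formalExp (-f)) =
      - PowerSeries.coeff n (D * formalExp (-f)) := by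
    intro n
    rw [euler_coeff_formalExp hg0 hg, PowerSeries.coeff_mul]
    simp [hD]
  have hDe : D * formalExp f = formalExp f * D := by
    ext n
    rw [PowerSeries.coeff_mul, PowerSeries.coeff_mul, ← Finset.Nat.sum_antidiagonal_swap]
    refine Finset.sum_congr rfl fun ij _ => ?_
    simp only [hD, PowerSeries.coeff_mk, Prod.fst_swap, Prod.snd_swap]
    exact ((commute_coeff_formalExp (hf _) _).smul_left _).eq
  ext n
  rcases Nat.eq_zero_or_pos n with rfl | hn
  · simp [PowerSeries.coeff_mul, coeff_zero_formalExp]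
  · apply eq_of_smul_eq hn.ne'
    rw [PowerSeries.coeff_mul, smul_sum_antidiagonal_mul n
      (fun i => PowerSeries.coeff i (formalExp f)) (fun i => PowerSeries.coeff i (formalExp (-f))),
      Finset.sum_add_distrib]
    simp only [e1, e2, mul_neg, Finset.sum_neg_distrib]
    rw [← PowerSeries.coeff_mul, ← PowerSeries.coeff_mul, hDe, mul_assoc, add_neg_cancel,
      PowerSeries.coeff_one, if_neg hn.ne', smul_zero]

end FormalExp

/-! ### Binomial coefficients and divided derivatives -/

theorem Ring.succ_mul_choose_eq_int (r : ℤ) (n : ℕ) :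
    ((n + 1 : ℕ) : ℤ) * Ring.choose r (n + 1) = r * Ring.choose (r - 1) n := by
  have h1 := Ring.descPochhammer_eq_factorial_smul_choose r (n + 1)
  have h2 := Ring.descPochhammer_eq_factorial_smul_choose (r - 1) n
  have h3 : (descPochhammer ℤ (n + 1)).smeval r = r * (descPochhammer ℤ n).smeval (r - 1) := by
    rw [descPochhammer_succ_left, Polynomial.smeval_X_mul, Polynomial.smeval_comp]
    simp
  rw [h3, h2, Nat.factorial_succ] at h1
  have : (n.factorial : ℤ) ≠ 0 := Nat.cast_ne_zero.2 n.factorial_ne_zero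
  apply mul_left_cancel₀ this
  simp only [nsmul_eq_mul] at h1
  push_cast at h1 ⊢
  linarith

theorem Ring.choose_neg_sub_one_int (j m : ℕ) :
    Ring.choose (-(j : ℤ) - 1) m = (-1) ^ m * ((j + m).choose m : ℤ) := by
  rw [show (-(j : ℤ) - 1) = -((j : ℤ) + 1) by ring, Ring.choose_neg]
  rw [show ((j : ℤ) + 1 + m - 1) = ((j + m : ℕ) : ℤ) by push_cast; ring, Ring.choose_natCast]
  rw [Units.smul_def, Int.coe_negOnePow_natCast, smul_eq_mul]

/-- Both sides are the coefficient of `tⁿ` in `(1 - t)⁻¹ (1 - t)^{r+1} = (1 - t)^r`. -/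
theorem Ring.sum_neg_one_pow_mul_choose_int (r : ℤ) (n : ℕ) :
    ∑ i ∈ Finset.range (n + 1), (-1) ^ i * Ring.choose (r + 1) i = (-1) ^ n * Ring.choose r n := by
  induction n with
  | zero => simp
  | succ n ih =>
    rw [Finset.sum_range_succ, ih, Ring.choose_succ_succ]
    ring

section Hasse

variable {A : Type*} [Ring A]

/-- For `e = ∑ e_k x^{σ k + b}` this is the `n`-th divided derivative of `e`, up to the factor `xⁿ`
and a renormalization of exponents. -/
def hasseSeries (σ b : ℤ) (e : ℕ → A) (n : ℕ) : A⟦X⟧ :=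
  PowerSeries.mk fun k => Ring.choose (σ * k + b) n • e k

/-- The hypothesis reads `e' = (x⁻¹ a) e`, and the conclusion is its `n`-th divided derivative by
the Leibniz rule; the `-1` on the right is the exponent of `x⁻¹`. On coefficients this is
Vandermonde's identity. The sign `σ` covers series in `x` and in `x⁻¹` together. -/
theorem succ_smul_hasseSeries_succ {σ b : ℤ} {a e : ℕ → A}
    (h : ∀ k : ℕ, (σ * k + b) • e k = ∑ uv ∈ antidiagonal k, a uv.1 * e uv.2) (n : ℕ) :
    ((n + 1 : ℕ) : ℤ) • hasseSeries σ b e (n + 1) =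
      ∑ ij ∈ antidiagonal n, hasseSeries σ (-1) a ij.1 * hasseSeries σ b e ij.2 := by
  ext k
  rw [map_zsmul, map_sum]
  simp only [hasseSeries, PowerSeries.coeff_mul, PowerSeries.coeff_mk]
  rw [smul_smul, Ring.succ_mul_choose_eq_int, mul_comm, ← smul_smul, h, Finset.sum_comm,
    Finset.smul_sum]
  refine Finset.sum_congr rfl fun uv huv => ?_
  simp only [smul_mul_smul_comm]
  rw [← Finset.sum_smul, ← Ring.add_choose_eq n (Commute.all _ _), ← mem_antidiagonal.1 huv]
  congr 2
  push_cast
  ring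

theorem hasseSeries_zero (σ b : ℤ) (e : ℕ → A) : hasseSeries σ b e 0 = PowerSeries.mk e := by
  ext k
  simp [hasseSeries]

end Hasse

/-! ### Reindexing of sums over triples with given total. -/

theorem sum_antidiagonal_fst_assoc {M : Type*} [AddCommMonoid M] (n : ℕ) (f : ℕ → ℕ → ℕ → M) :
    ∑ p ∈ antidiagonal n, ∑ q ∈ antidiagonal p.1, f q.1 q.2 p.2 =
      ∑ p ∈ antidiagonal n, ∑ q ∈ antidiagonal p.2, f p.1 q.1 q.2 := by
  rw [Finset.sum_sigma', Finset.sum_sigma']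
  refine Finset.sum_nbij' (fun x => ⟨(x.2.1, x.2.2 + x.1.2), (x.2.2, x.1.2)⟩)
    (fun x => ⟨(x.1.1 + x.2.1, x.2.2), (x.1.1, x.2.1)⟩) ?_ ?_ ?_ ?_ ?_
  all_goals
    rintro ⟨⟨a, b⟩, c, d⟩ h
    simp only [Finset.mem_sigma, mem_antidiagonal] at h ⊢
  · exact ⟨by omega, trivial⟩
  · exact ⟨by omega, trivial⟩
  · obtain ⟨-, rfl⟩ := h; rfl
  · obtain ⟨-, rfl⟩ := h; rfl

theorem sum_antidiagonal_snd_comm {M : Type*} [AddCommMonoid M] (n : ℕ) (f : ℕ → ℕ → ℕ → M) :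
    ∑ p ∈ antidiagonal n, ∑ q ∈ antidiagonal p.2, f p.1 q.1 q.2 =
      ∑ p ∈ antidiagonal n, ∑ q ∈ antidiagonal p.2, f q.1 p.1 q.2 := by
  rw [← sum_antidiagonal_fst_assoc, ← sum_antidiagonal_fst_assoc n fun a b c => f b a c]
  refine Finset.sum_congr rfl fun p _ => ?_
  rw [← Finset.Nat.sum_antidiagonal_swap]
  rfl

noncomputable section

namespace LatticeVertex

variable {L : Type*} [AddCommGroup L]

/-! ### The coefficients of `E⁻` and `E⁺` -/

theorem creation_neg (h : Cartan L) (k : ℕ) : creation (-h) k = -creation h k := by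
  simp [creation]

theorem toCartan_neg (α : L) : toCartan (-α) = -toCartan α := by
  simp [TensorProduct.tmul_neg]

/-- The coefficient of `xⁿ` in `E⁻(-γ, x)`. -/
def schur (γ : L) (n : ℕ) : Fock L := PowerSeries.coeff n (expMinus γ)

theorem schur_zero (γ : L) : schur γ 0 = 1 := coeff_zero_formalExp _

/-- This is `(d/dx) E⁻ = γ(x)₋ E⁻`; the factors `1 / n` of the exponent cancel. Later facts about
`E⁻` are mostly deduced from this recursion. -/
theorem succ_smul_schur (γ : L) (n : ℕ) :
    ((n + 1 : ℕ) : ℂ) • schur γ (n + 1) =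
      ∑ ij ∈ antidiagonal n, creation (toCartan γ) ij.1 * schur γ ij.2 := by
  rw [schur, expMinus, succ_smul_coeff_formalExp (by simp) (fun _ _ => Commute.all _ _)]
  refine Finset.sum_congr rfl fun ij _ => ?_
  have : ((ij.1 + 1 : ℕ) : ℂ) ≠ 0 := Nat.cast_ne_zero.2 (by omega)
  simp only [PowerSeries.coeff_mk, Nat.add_eq_zero_iff, one_ne_zero, and_false, if_false, smul_smul,
    mul_inv_cancel₀ this, one_smul, Nat.add_sub_cancel]
  rfl

theorem schur_one (γ : L) : schur γ 1 = creation (toCartan γ) 0 := by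
  simpa [schur_zero] using succ_smul_schur γ 0

theorem expMinus_mul_expMinus_neg (γ : L) : expMinus γ * expMinus (-γ) = 1 := by
  rw [expMinus, expMinus, ← formalExp_mul_formalExp_neg _ (fun _ _ => Commute.all _ _)]
  · congr 2
    ext n : 1
    simp only [PowerSeries.coeff_mk, map_neg, toCartan_neg, creation_neg]
    split_ifs <;> simp
  · simp

variable (B : LinearMap.BilinForm ℤ L)

theorem commute_annihilation (h h' : Cartan L) (n n' : ℕ) :
    Commute (annihilation B h n : Fock L →ₗ[ℂ] Fock L)
      (annihilation B h' n' : Fock L →ₗ[ℂ] Fock L) :=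
  LinearMap.ext fun q => annihilation_comm B h h' n n' q

theorem commute_coeff_expPlusExponent (γ : L) (i j : ℕ) :
    Commute (PowerSeries.coeff i (PowerSeries.mk fun n => if n = 0 then 0 else
      (-(n : ℂ)⁻¹) • (annihilation B (toCartan γ) n : Fock L →ₗ[ℂ] Fock L)))
      (PowerSeries.coeff j (PowerSeries.mk fun n => if n = 0 then 0 else
      (-(n : ℂ)⁻¹) • (annihilation B (toCartan γ) n : Fock L →ₗ[ℂ] Fock L))) := by
  simp only [PowerSeries.coeff_mk]
  split_ifs
  · exact Commute.zero_left _
  · exact Commute.zero_left _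
  · exact Commute.zero_right _
  · exact ((commute_annihilation B _ _ _ _).smul_left _).smul_right _

theorem coeff_zero_expPlus (γ : L) : PowerSeries.coeff 0 (expPlus B γ) = 1 :=
  coeff_zero_formalExp _

theorem succ_smul_coeff_expPlus (γ : L) (n : ℕ) :
    ((n + 1 : ℕ) : ℂ) • PowerSeries.coeff (n + 1) (expPlus B γ) =
      -∑ ij ∈ antidiagonal n, (annihilation B (toCartan γ) (ij.1 + 1) : Fock L →ₗ[ℂ] Fock L) *
        PowerSeries.coeff ij.2 (expPlus B γ) := by
  rw [expPlus, succ_smul_coeff_formalExp (by simp) (commute_coeff_expPlusExponent B γ),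
    ← Finset.sum_neg_distrib]
  refine Finset.sum_congr rfl fun ij _ => ?_
  have : ((ij.1 + 1 : ℕ) : ℂ) ≠ 0 := Nat.cast_ne_zero.2 (by omega)
  simp only [PowerSeries.coeff_mk, Nat.add_eq_zero_iff, one_ne_zero, and_false, if_false, smul_smul,
    mul_neg, mul_inv_cancel₀ this, neg_smul, one_smul]
  exact neg_mul (α := Module.End ℂ (Fock L)) _ _

theorem succ_smul_coeff_expPlus_apply (γ : L) (n : ℕ) (q : Fock L) :
    ((n + 1 : ℕ) : ℂ) • PowerSeries.coeff (n + 1) (expPlus B γ) q =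
      -∑ ij ∈ antidiagonal n, annihilation B (toCartan γ) (ij.1 + 1)
        (PowerSeries.coeff ij.2 (expPlus B γ) q) := by
  rw [← LinearMap.smul_apply, succ_smul_coeff_expPlus]
  simp [LinearMap.sum_apply]

theorem annihilation_neg (h : Cartan L) (n : ℕ) :
    annihilation B (-h) n = -annihilation B h n := by
  rw [← neg_one_smul ℂ h, annihilation_smul]
  exact neg_one_smul ℂ (annihilation B h n)

theorem expPlus_mul_expPlus_neg (γ : L) : expPlus B γ * expPlus B (-γ) = 1 := by
  rw [expPlus, expPlus, ← formalExp_mul_formalExp_neg _ (commute_coeff_expPlusExponent B γ)]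
  · congr 2
    ext n : 1
    simp only [PowerSeries.coeff_mk, map_neg, toCartan_neg, annihilation_neg]
    split_ifs
    · simp
    · ext q; simp
  · simp

theorem annihilation_creation (h g : Cartan L) (n k : ℕ) :
    annihilation B h (n + 1) (creation g k) =
      if k = n then algebraMap ℂ (Fock L) ((n + 1 : ℕ) * cform B h g) else 0 := by
  rw [creation, annihilation_ι, Nat.add_sub_cancel, Finsupp.single_apply]
  split_ifs <;> simp

/-- A derivation multiplies an exponential by its value on the exponent, here `⟨h, γ⟩ y^{j+1}`.
Writing the shift as a factor `X ^ (j + 1)` avoids a separate case for small `n`. -/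
theorem annihilation_schur (h : Cartan L) (γ : L) (j n : ℕ) :
    annihilation B h (j + 1) (schur γ n) =
      cform B h (toCartan γ) • PowerSeries.coeff n (PowerSeries.X ^ (j + 1) * expMinus γ) := by
  induction n using Nat.strong_induction_on with
  | _ n ih =>
  cases n with
  | zero => simp [schur_zero, PowerSeries.coeff_X_pow_mul']
  | succ n =>
  apply eq_of_smul_eq n.succ_ne_zero
  rw [← Derivation.map_smul, Nat.succ_eq_add_one, succ_smul_schur, map_sum]
  simp only [Derivation.leibniz, smul_eq_mul, Finset.sum_add_distrib]
  have hE : ∀ n : ℕ, (n : ℂ) • schur γ n = PowerSeries.coeff n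
      (PowerSeries.X * (PowerSeries.mk (creation (toCartan γ)) * expMinus γ)) := by
    intro n
    cases n with
    | zero => simp
    | succ n =>
      rw [succ_smul_schur, PowerSeries.coeff_succ_X_mul, PowerSeries.coeff_mul]
      simp [schur]
  have h1 : ∑ ij ∈ antidiagonal n, creation (toCartan γ) ij.1 *
      annihilation B h (j + 1) (schur γ ij.2) = cform B h (toCartan γ) •
        PowerSeries.coeff (n + 1) (PowerSeries.X ^ (j + 1) *
          (PowerSeries.X * (PowerSeries.mk (creation (toCartan γ)) * expMinus γ))) := by
    rw [show PowerSeries.X ^ (j + 1) *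
          (PowerSeries.X * (PowerSeries.mk (creation (toCartan γ)) * expMinus γ)) =
          PowerSeries.X * (PowerSeries.mk (creation (toCartan γ)) *
            (PowerSeries.X ^ (j + 1) * expMinus γ)) by ring, PowerSeries.coeff_succ_X_mul,
      PowerSeries.coeff_mul, Finset.smul_sum]
    refine Finset.sum_congr rfl fun ij hij => ?_
    have hij := mem_antidiagonal.1 hij
    rw [ih ij.2 (by omega), PowerSeries.coeff_mk, mul_smul_comm]
  have h2 : ∑ ij ∈ antidiagonal n, schur γ ij.2 * annihilation B h (j + 1)
      (creation (toCartan γ) ij.1) =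
      if j ≤ n then (((j + 1 : ℕ) : ℂ) * cform B h (toCartan γ)) • schur γ (n - j) else 0 := by
    simp only [annihilation_creation]
    split_ifs with hj
    · rw [Finset.sum_eq_single (j, n - j)]
      · rw [if_pos rfl, mul_comm, Algebra.smul_def]
      · rintro ⟨a, b⟩ hab hne
        have := mem_antidiagonal.1 hab
        simp only at this ⊢
        rw [if_neg, mul_zero]
        rintro rfl
        exact hne (by rw [Prod.mk.injEq]; omega)
      · intro h; exact absurd (mem_antidiagonal.2 (by simp only; omega)) h
    · refine Finset.sum_eq_zero fun ij hij => ?_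
      have hij := mem_antidiagonal.1 hij
      rw [if_neg (by omega), mul_zero]
  -- For `j ≤ n` the two sums are `n - j` and `j + 1` times `⟨h, γ⟩ s_γ(n - j)`, which add up to the
  -- required factor `n + 1`.
  rw [h1, h2, PowerSeries.coeff_X_pow_mul', PowerSeries.coeff_X_pow_mul', ← hE]
  by_cases hj : j ≤ n
  · rw [if_pos hj, if_pos (by omega), if_pos (by omega), show n + 1 - (j + 1) = n - j by omega,
      smul_smul, ← add_smul, smul_smul]
    change _ = _ • schur γ (n - j)
    congr 1
    rw [Nat.cast_sub hj]
    push_cast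
    ring
  · rw [if_neg hj, if_neg (by omega), if_neg (by omega)]
    simp

variable {B}

/-- The Leibniz rule `(uv)' = u'v + uv'` for generating series. -/
theorem succ_nsmul_sum_antidiagonal {R : Type*} [Ring R] (n : ℕ) (u v : ℕ → R) :
    (n + 1) • ∑ ij ∈ antidiagonal (n + 1), u ij.1 * v ij.2 =
      ∑ ij ∈ antidiagonal n, ((ij.1 + 1) • u (ij.1 + 1)) * v ij.2 +
        ∑ ij ∈ antidiagonal n, u ij.1 * ((ij.2 + 1) • v (ij.2 + 1)) := by
  have h : ∀ ij ∈ antidiagonal (n + 1), (n + 1) • (u ij.1 * v ij.2) =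
      (ij.1 • u ij.1) * v ij.2 + u ij.1 * (ij.2 • v ij.2) := by
    intro ij hij
    rw [← mem_antidiagonal.1 hij, add_smul, smul_mul_assoc, mul_smul_comm]
  rw [Finset.smul_sum, Finset.sum_congr rfl h, Finset.sum_add_distrib,
    Finset.Nat.sum_antidiagonal_succ, Finset.Nat.sum_antidiagonal_succ'
      (f := fun ij : ℕ × ℕ => u ij.1 * (ij.2 • v ij.2))]
  simp

/-- The exponential of a derivation is multiplicative. Both sides obey the recursion for `E⁺`, the
right one by the Leibniz rule for the `α(i)`. -/
theorem coeff_expPlus_mul (α : L) (n : ℕ) (p q : Fock L) :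
    PowerSeries.coeff n (expPlus B α) (p * q) = ∑ ij ∈ antidiagonal n,
      PowerSeries.coeff ij.1 (expPlus B α) p * PowerSeries.coeff ij.2 (expPlus B α) q := by
  induction n using Nat.strong_induction_on with
  | _ n ih =>
  cases n with
  | zero => simp [coeff_zero_expPlus]
  | succ n =>
    apply eq_of_smul_eq n.succ_ne_zero
    rw [Nat.succ_eq_add_one, Nat.cast_smul_eq_nsmul ℂ (n + 1) (∑ ij ∈ antidiagonal (n + 1), _),
      succ_nsmul_sum_antidiagonal n
      (fun i => PowerSeries.coeff i (expPlus B α) p) (fun i => PowerSeries.coeff i (expPlus B α) q),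
      succ_smul_coeff_expPlus_apply]
    have h : ∀ ij ∈ antidiagonal n, annihilation B (toCartan α) (ij.1 + 1)
        (PowerSeries.coeff ij.2 (expPlus B α) (p * q)) =
        ∑ uv ∈ antidiagonal ij.2, annihilation B (toCartan α) (ij.1 + 1)
          (PowerSeries.coeff uv.1 (expPlus B α) p) * PowerSeries.coeff uv.2 (expPlus B α) q +
        ∑ uv ∈ antidiagonal ij.2, PowerSeries.coeff uv.1 (expPlus B α) p *
          annihilation B (toCartan α) (ij.1 + 1) (PowerSeries.coeff uv.2 (expPlus B α) q) := by
      intro ij hij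
      have hij := mem_antidiagonal.1 hij
      rw [ih ij.2 (by omega), map_sum, ← Finset.sum_add_distrib]
      refine Finset.sum_congr rfl fun uv _ => ?_
      rw [Derivation.leibniz, smul_eq_mul, smul_eq_mul, add_comm, 
        mul_comm (PowerSeries.coeff uv.2 (expPlus B α) q)]
    rw [Finset.sum_congr rfl h, Finset.sum_add_distrib, neg_add]
    congr 1
    · rw [← sum_antidiagonal_fst_assoc n fun i u v => annihilation B (toCartan α) (i + 1)
        (PowerSeries.coeff u (expPlus B α) p) * PowerSeries.coeff v (expPlus B α) q,
        ← Finset.sum_neg_distrib]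
      refine Finset.sum_congr rfl fun ij _ => ?_
      rw [← Nat.cast_smul_eq_nsmul ℂ, succ_smul_coeff_expPlus_apply, neg_mul, Finset.sum_mul]
    · rw [sum_antidiagonal_snd_comm n fun i u v => PowerSeries.coeff u (expPlus B α) p *
        annihilation B (toCartan α) (i + 1) (PowerSeries.coeff v (expPlus B α) q),
        ← Finset.sum_neg_distrib]
      refine Finset.sum_congr rfl fun ij _ => ?_
      rw [← Nat.cast_smul_eq_nsmul ℂ, succ_smul_coeff_expPlus_apply, mul_neg, Finset.mul_sum]

theorem annihilation_coeff_X_pow_mul_expMinus (h : Cartan L) (γ : L) (i j n : ℕ) :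
    annihilation B h (i + 1) (PowerSeries.coeff n (PowerSeries.X ^ j * expMinus γ)) =
      cform B h (toCartan γ) •
        PowerSeries.coeff n (PowerSeries.X ^ (i + j + 1) * expMinus γ) := by
  rw [PowerSeries.coeff_X_pow_mul', PowerSeries.coeff_X_pow_mul']
  split_ifs with h1 h2 h2
  · change annihilation B h (i + 1) (schur γ (n - j)) = _
    rw [annihilation_schur, PowerSeries.coeff_X_pow_mul', if_pos (by omega)]
    congr 3
    omega
  · change annihilation B h (i + 1) (schur γ (n - j)) = _
    rw [annihilation_schur, PowerSeries.coeff_X_pow_mul', if_neg (by omega)]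
  · omega
  · simp

theorem cform_toCartan (α β : L) : cform B (toCartan α) (toCartan β) = (B α β : ℂ) := by
  simp [LinearMap.BilinForm.baseChange_tmul]

/-- Coefficient form of `E⁺(-α, x) E⁻(-γ, y) 𝟏 = (1 - y/x)^{⟨α,γ⟩} E⁻(-γ, y) 𝟏`. Integrality enters
here: the exponent is an integer, so its binomials are too. -/
theorem coeff_expPlus_schur (α γ : L) (k n : ℕ) :
    PowerSeries.coeff k (expPlus B α) (schur γ n) =
      ((-1) ^ k * Ring.choose (B α γ) k) •
        PowerSeries.coeff n (PowerSeries.X ^ k * expMinus γ) := by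
  induction k using Nat.strong_induction_on with
  | _ k ih =>
  cases k with
  | zero => simp [coeff_zero_expPlus, schur]
  | succ k =>
    apply eq_of_smul_eq k.succ_ne_zero
    rw [Nat.succ_eq_add_one, succ_smul_coeff_expPlus_apply]
    have h : ∀ ij ∈ antidiagonal k, annihilation B (toCartan α) (ij.1 + 1)
        (PowerSeries.coeff ij.2 (expPlus B α) (schur γ n)) =
        (B α γ * ((-1) ^ ij.2 * Ring.choose (B α γ) ij.2)) •
          PowerSeries.coeff n (PowerSeries.X ^ (k + 1) * expMinus γ) := by
      intro ij hij
      have hij := mem_antidiagonal.1 hij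
      rw [ih ij.2 (by omega), map_zsmul, annihilation_coeff_X_pow_mul_expMinus, cform_toCartan,
        Int.cast_smul_eq_zsmul, smul_smul, mul_comm, hij]
    rw [Finset.sum_congr rfl h, ← Finset.sum_smul, ← Finset.mul_sum,
      ← Finset.Nat.sum_antidiagonal_swap]
    simp only [Prod.snd_swap]
    rw [Finset.Nat.sum_antidiagonal_eq_sum_range_succ_mk]
    -- The recursion produces a partial alternating sum of the binomials of `⟨α, γ⟩`, which
    -- collapses to one binomial of `⟨α, γ⟩ - 1`.
    have h2 := Ring.sum_neg_one_pow_mul_choose_int (B α γ - 1) k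
    rw [sub_add_cancel] at h2
    simp only
    rw [h2, ← neg_smul, Nat.cast_smul_eq_nsmul, ← natCast_zsmul, smul_smul]
    congr 1
    have h3 := Ring.succ_mul_choose_eq_int (B α γ) k
    rw [pow_succ]
    linear_combination (-1) ^ k * h3

/-! ### Locally finite series of operators -/

namespace IsBounded

theorem add {N : ℕ} {p q : Fock L} (hp : IsBounded B N p) (hq : IsBounded B N q) :
    IsBounded B N (p + q) := by
  intro l hl
  rw [foldl_add, hp l hl, hq l hl, add_zero]

theorem zero (N : ℕ) : IsBounded B N (0 : Fock L) := fun l _ => foldl_zero l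

theorem sum {N : ℕ} {κ : Type*} (s : Finset κ) (f : κ → Fock L)
    (h : ∀ i ∈ s, IsBounded B N (f i)) : IsBounded B N (∑ i ∈ s, f i) := by
  classical
  induction s using Finset.induction_on with
  | empty => exact zero N
  | insert a s ha ih =>
    rw [Finset.sum_insert ha]
    exact (h a (Finset.mem_insert_self a s)).add
      (ih fun i hi => h i (Finset.mem_insert_of_mem hi))

theorem zsmul {N : ℕ} {q : Fock L} (hq : IsBounded B N q) (c : ℤ) : IsBounded B N (c • q) := by
  rw [← Int.cast_smul_eq_zsmul ℂ]
  exact hq.smul _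

end IsBounded

variable (B) in
/-- Series of operators whose `k`-th coefficient lowers the degree by `k`. -/
def IsLowering (ρ : (Module.End ℂ (Fock L))⟦X⟧) : Prop :=
  ∀ (N : ℕ) (q : Fock L) (k : ℕ), IsBounded B N q →
    IsBounded B (N - k) (PowerSeries.coeff k ρ q) ∧ (N < k → PowerSeries.coeff k ρ q = 0)

theorem isLowering_expPlus (γ : L) : IsLowering B (expPlus B γ) := by
  intro N q k hq
  refine ⟨?_, expPlus_coeff_eq_zero γ hq⟩
  induction k using Nat.strong_induction_on with
  | _ k ih =>
  cases k with
  | zero => simpa [coeff_zero_expPlus] using hq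
  | succ k =>
    have h0 : ((k + 1 : ℕ) : ℂ) ≠ 0 := Nat.cast_ne_zero.2 (by omega)
    rw [← one_smul ℂ (PowerSeries.coeff (k + 1) (expPlus B γ) q), ← inv_mul_cancel₀ h0, ← smul_smul,
      succ_smul_coeff_expPlus_apply, ← neg_one_smul ℂ]
    refine ((IsBounded.sum _ _ fun ij hij => ?_).smul _).smul _
    have hij := mem_antidiagonal.1 hij
    exact ((ih ij.2 (by omega)).annih (toCartan γ) (ij.1 + 1)).mono (by omega)

theorem IsLowering.mul {ρ σ : (Module.End ℂ (Fock L))⟦X⟧} (hρ : IsLowering B ρ)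
    (hσ : IsLowering B σ) : IsLowering B (ρ * σ) := by
  intro N q k hq
  rw [PowerSeries.coeff_mul, LinearMap.sum_apply]
  refine ⟨IsBounded.sum _ _ fun ij hij => ?_, fun hk => Finset.sum_eq_zero fun ij hij => ?_⟩
  all_goals
    have hij := mem_antidiagonal.1 hij
    rw [Module.End.mul_apply]
  · exact (hρ _ _ ij.1 (hσ N q ij.2 hq).1).1.mono (by omega)
  -- For `N < ij.2` the truncated bound `N - ij.2` is `0` and too weak; here `σ` already kills `q`.
  · by_cases h : N < ij.2
    · rw [(hσ N q ij.2 hq).2 h, map_zero]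
    · exact (hρ _ _ ij.1 (hσ N q ij.2 hq).1).2 (by omega)

theorem IsLowering.hasseSeries {ρ : (Module.End ℂ (Fock L))⟦X⟧} (hρ : IsLowering B ρ) (σ b : ℤ)
    (n : ℕ) : IsLowering B (hasseSeries σ b (fun k => PowerSeries.coeff k ρ) n) := by
  intro N q k hq
  rw [_root_.hasseSeries, PowerSeries.coeff_mk, LinearMap.smul_apply]
  exact ⟨(hρ N q k hq).1.zsmul _, fun hk => by rw [(hρ N q k hq).2 hk, smul_zero]⟩

/-! ### Normal ordered exponentials -/

/-- `γ(x)₋`, with exponents shifted by one. -/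
def minusCurrent (γ : L) (n : ℕ) : (Fock L)⟦X⟧ :=
  hasseSeries 1 (-1) (fun u => if u = 0 then 0 else creation (toCartan γ) (u - 1)) n

/-- The coefficient of `yⁿ` in `E⁻(-γ, x + y) E⁻(-γ, x)⁻¹`, multiplied by `xⁿ`. -/
def minusShift (γ : L) (n : ℕ) : (Fock L)⟦X⟧ :=
  hasseSeries 1 0 (schur γ) n * expMinus (-γ)

variable (B) in
/-- `γ(x)₊` on the summand `S(𝔥̂₋) ⊗ e_β`, as a series in `x⁻¹` with exponents shifted by one. -/
def plusCurrent (γ β : L) (n : ℕ) : (Module.End ℂ (Fock L))⟦X⟧ :=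
  hasseSeries (-1) (-1) (mode B β (toCartan γ)) n

variable (B) in
/-- The coefficient of `yⁿ` in `(1 + y / x)^{⟨γ, β⟩} E⁺(-γ, x + y) E⁺(-γ, x)⁻¹`, multiplied by `xⁿ`,
as a series in `x⁻¹`. -/
def plusShift (γ β : L) (n : ℕ) : (Module.End ℂ (Fock L))⟦X⟧ :=
  hasseSeries (-1) (B γ β) (fun k => PowerSeries.coeff k (expPlus B γ)) n * expPlus B (-γ)

theorem minusShift_zero (γ : L) : minusShift γ 0 = 1 := by
  rw [minusShift, hasseSeries_zero, ← expMinus_mul_expMinus_neg γ]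
  congr 1
  ext k
  simp [schur]

theorem plusShift_zero (γ β : L) : plusShift B γ β 0 = 1 := by
  rw [plusShift, hasseSeries_zero, ← expPlus_mul_expPlus_neg B γ]
  congr 1
  ext k : 1
  simp

/-- As a function of `y`, `E⁻(-γ, x+y) E⁻(-γ, x)⁻¹` has logarithmic derivative `γ(x+y)₋`; the second
factor does not depend on `y`. -/
theorem succ_smul_minusShift (γ : L) (n : ℕ) :
    ((n + 1 : ℕ) : ℤ) • minusShift γ (n + 1) =
      ∑ ij ∈ antidiagonal n, minusCurrent γ ij.1 * minusShift γ ij.2 := by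
  simp only [minusShift, ← mul_assoc, ← Finset.sum_mul, minusCurrent]
  rw [← smul_mul_assoc, succ_smul_hasseSeries_succ]
  intro k
  cases k with
  | zero => simp
  | succ k =>
    rw [Finset.Nat.sum_antidiagonal_succ]
    simp only [if_true, zero_mul, zero_add, Nat.add_eq_zero_iff, one_ne_zero, and_false, if_false,
      Nat.add_sub_cancel]
    rw [← succ_smul_schur, one_mul, add_zero, ← Int.cast_smul_eq_zsmul ℂ, Int.cast_natCast]

/-- The series `x^{⟨γ,β⟩} E⁺(-γ, x)` has logarithmic derivative `γ(x)₊`: the power of `x` accounts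
for the zero mode `⟨γ, β⟩` on `e_β`, and `E⁺` for the positive modes. -/
theorem succ_smul_plusShift (γ β : L) (n : ℕ) :
    ((n + 1 : ℕ) : ℤ) • plusShift B γ β (n + 1) =
      ∑ ij ∈ antidiagonal n, plusCurrent B γ β ij.1 * plusShift B γ β ij.2 := by
  simp only [plusShift, ← mul_assoc, ← Finset.sum_mul, plusCurrent]
  rw [← smul_mul_assoc, succ_smul_hasseSeries_succ]
  have h0 : mode B β (toCartan γ) 0 = (B γ β : ℤ) • (1 : Module.End ℂ (Fock L)) := by
    rw [mode, if_pos rfl, cform_toCartan]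
    exact Int.cast_smul_eq_zsmul ℂ (B γ β) (1 : Module.End ℂ (Fock L))
  intro k
  cases k with
  | zero => simp [h0, coeff_zero_expPlus]
  | succ k =>
    rw [Finset.Nat.sum_antidiagonal_succ, h0, add_smul, add_comm, smul_mul_assoc, one_mul]
    congr 1
    rw [neg_one_mul, neg_smul, neg_eq_iff_eq_neg, ← Int.cast_smul_eq_zsmul ℂ, Int.cast_natCast,
      succ_smul_coeff_expPlus]
    rfl

theorem isLowering_plusShift (γ β : L) (n : ℕ) : IsLowering B (plusShift B γ β n) :=
  ((isLowering_expPlus γ).hasseSeries _ _ _).mul (isLowering_expPlus _)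

theorem normalOrder_creation (β : L) (h : Cartan L) (n : ℕ) :
    normalOrder B β (creation h n) = normalMul B β n h := by
  rw [normalOrder, creation, SymmetricAlgebra.liftCommute_ι, heisNormalMul, Finsupp.lsum_single]

theorem xpow_mul_xpow (a b : ℤ) : xpow L a * xpow L b = xpow L (a + b) := by
  simp [HahnSeries.single_mul_single]

theorem ofPowerSeries_currentMinus (γ : L) (n : ℕ) :
    HahnSeries.ofPowerSeries ℤ (Fock L) (currentMinus (toCartan γ) n) =
      xpow L (-n - 1) * HahnSeries.ofPowerSeries ℤ (Fock L) (minusCurrent γ n) := by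
  have : minusCurrent γ n = PowerSeries.X ^ (n + 1) * currentMinus (toCartan γ) n := by
    ext k
    rw [PowerSeries.coeff_X_pow_mul', minusCurrent, hasseSeries, PowerSeries.coeff_mk]
    cases k with
    | zero => simp
    | succ k =>
      rw [if_neg k.succ_ne_zero, show (1 * ((k + 1 : ℕ) : ℤ) + -1) = (k : ℤ) by push_cast; ring,
        Ring.choose_natCast, natCast_zsmul, ← Nat.cast_smul_eq_nsmul ℂ, Nat.add_sub_cancel]
      split_ifs with h
      · obtain ⟨m, rfl⟩ := Nat.exists_eq_add_of_le' (show n ≤ k by omega)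
        rw [currentMinus, PowerSeries.coeff_mk, show m + n + 1 - (n + 1) = m by omega]
      · rw [Nat.choose_eq_zero_of_lt (by omega), Nat.cast_zero, zero_smul]
  rw [this, map_mul, HahnSeries.ofPowerSeries_X_pow, ← mul_assoc, xpow_mul_xpow]
  simp

/-- `∑_{k < K} x^{-k} X(ρ_k q)`, the value at `q` of the composition of a field `X` with a series
`ρ` in `x⁻¹` of operators. -/
def compSeries (K : ℕ) (q : Fock L) (X : Field L) (ρ : (Module.End ℂ (Fock L))⟦X⟧) :
    LaurentSeries (Fock L) :=
  ∑ k ∈ Finset.range K, xpow L (-k) * X (PowerSeries.coeff k ρ q)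

theorem compSeries_sum (K : ℕ) (q : Fock L) (X : Field L) {κ : Type*} (s : Finset κ)
    (ρ : κ → (Module.End ℂ (Fock L))⟦X⟧) :
    compSeries K q X (∑ i ∈ s, ρ i) = ∑ i ∈ s, compSeries K q X (ρ i) := by
  simp only [compSeries, map_sum, LinearMap.sum_apply, Finset.mul_sum]
  exact Finset.sum_comm

theorem compSeries_zsmul (K : ℕ) (q : Fock L) (X : Field L) (c : ℤ)
    (ρ : (Module.End ℂ (Fock L))⟦X⟧) :
    compSeries K q X (c • ρ) = c • compSeries K q X ρ := by
  simp only [compSeries, map_zsmul, LinearMap.smul_apply, mul_smul_comm, Finset.smul_sum]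

theorem normalMul_apply (β γ : L) (n : ℕ) (X : Field L) {K N : ℕ} {q : Fock L}
    (hq : IsBounded B N q) (hK : N < K) :
    normalMul B β n (toCartan γ) X q = xpow L (-n - 1) *
      (HahnSeries.ofPowerSeries ℤ (Fock L) (minusCurrent γ n) * X q +
        compSeries K q X (plusCurrent B γ β n)) := by
  obtain ⟨K, rfl⟩ := Nat.exists_eq_add_of_lt hK
  have h1 : normalMul B β n (toCartan γ) X q =
      HahnSeries.ofPowerSeries ℤ (Fock L) (currentMinus (toCartan γ) n) * X q +
        rightMul B β (toCartan γ) n X q := rfl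
  rw [h1, rightMul_apply β _ n X (hq.mono (show N ≤ N + K by omega)), ofPowerSeries_currentMinus,
    mul_add, mul_assoc, compSeries, Finset.mul_sum]
  congr 1
  refine Finset.sum_congr rfl fun j _ => ?_
  rw [rightTerm, plusCurrent, hasseSeries, PowerSeries.coeff_mk,
    show (-1 * (j : ℤ) + -1) = -(j : ℤ) - 1 by ring, Ring.choose_neg_sub_one_int,
    LinearMap.smul_apply, map_zsmul, mul_smul_comm, mul_smul_comm, ← mul_assoc, xpow_mul_xpow,
    ← Int.cast_smul_eq_zsmul ℂ]
  push_cast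
  congr 3
  ring_nf

/-- Composition is associative, `X(ρσ) = (Xρ)σ`. The square of indices and the triangle `k + l < K`
give the same sum, as all terms with `k + l > N` vanish. -/
theorem compSeries_mul (X : Field L) {ρ σ : (Module.End ℂ (Fock L))⟦X⟧} {K N : ℕ} {q : Fock L}
    (hρ : IsLowering B ρ) (hσ : IsLowering B σ) (hq : IsBounded B N q) (hK : N < K) :
    compSeries K q X (ρ * σ) = ∑ k ∈ Finset.range K,
      xpow L (-k) * compSeries K (PowerSeries.coeff k σ q) X ρ := by
  have h1 : ∀ k ∈ Finset.range K, xpow L (-k) * X (PowerSeries.coeff k (ρ * σ) q) =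
      ∑ m ∈ Finset.range (k + 1), xpow L (-(m : ℤ)) * (xpow L (-((k - m : ℕ) : ℤ)) *
        X (PowerSeries.coeff (k - m) ρ (PowerSeries.coeff m σ q))) := by
    intro k _
    rw [PowerSeries.coeff_mul, LinearMap.sum_apply, map_sum, Finset.mul_sum,
      ← Finset.Nat.sum_antidiagonal_swap, Finset.Nat.sum_antidiagonal_eq_sum_range_succ_mk]
    refine Finset.sum_congr rfl fun m hm => ?_
    have hm := Finset.mem_range.1 hm
    rw [← mul_assoc, xpow_mul_xpow, Module.End.mul_apply]
    congr 2
    push_cast [show m ≤ k by omega]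
    ring
  rw [compSeries, Finset.sum_congr rfl h1, Finset.sum_range_diag_flip K fun m l =>
    xpow L (-(m : ℤ)) * (xpow L (-(l : ℤ)) *
        X (PowerSeries.coeff l ρ (PowerSeries.coeff m σ q)))]
  refine Finset.sum_congr rfl fun m _ => ?_
  rw [← Finset.mul_sum, compSeries]
  congr 1
  refine Finset.sum_subset (fun x hx => ?_) fun l hl hl' => ?_
  · simp only [Finset.mem_range] at *; omega
  · simp only [Finset.mem_range] at *
    by_cases h : N < m
    · rw [(hσ N q m hq).2 h, map_zero, map_zero, mul_zero]
    · rw [(hρ _ _ l (hσ N q m hq).1).2 (by omega), map_zero, mul_zero]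

theorem isLowering_plusCurrent (γ β : L) (n : ℕ) : IsLowering B (plusCurrent B γ β n) := by
  intro N q k hq
  rw [plusCurrent, hasseSeries, PowerSeries.coeff_mk, LinearMap.smul_apply]
  refine ⟨IsBounded.zsmul ?_ _, fun hk => by rw [hq.mode_eq_zero β _ hk, smul_zero]⟩
  cases k with
  | zero => exact hq.mode β _ 0
  | succ k => exact hq.annih _ _

/-- This is `(h₋ X + X h₊) ρ = h₋ (X ρ) + X (h₊ ρ)`: a further current multiplies the left factor
and the series on the right separately. -/
theorem compSeries_normalMul (β γ : L) (n : ℕ) (X : Field L) {ρ : (Module.End ℂ (Fock L))⟦X⟧}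
    (hρ : IsLowering B ρ) {K N : ℕ} {q : Fock L} (hq : IsBounded B N q) (hK : N < K) :
    compSeries K q (normalMul B β n (toCartan γ) X) ρ = xpow L (-n - 1) *
      (HahnSeries.ofPowerSeries ℤ (Fock L) (minusCurrent γ n) * compSeries K q X ρ +
        compSeries K q X (plusCurrent B γ β n * ρ)) := by
  rw [compSeries_mul X (isLowering_plusCurrent γ β n) hρ hq hK]
  rw [compSeries, compSeries, Finset.mul_sum, ← Finset.sum_add_distrib, Finset.mul_sum]
  refine Finset.sum_congr rfl fun k _ => ?_
  rw [normalMul_apply β γ n X (hρ N q k hq).1 (show N - k < K by omega)]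
  ring

/-- The normal ordered product of a field with a coefficient of `E⁻(-γ, y)`. -/
theorem normalOrder_schur_apply (β γ : L) (n : ℕ) (X : Field L) {K N : ℕ} {q : Fock L}
    (hq : IsBounded B N q) (hK : N < K) :
    normalOrder B β (schur γ n) X q = xpow L (-n) * ∑ ij ∈ antidiagonal n,
      HahnSeries.ofPowerSeries ℤ (Fock L) (minusShift γ ij.1) *
        compSeries K q X (plusShift B γ β ij.2) := by
  induction n using Nat.strong_induction_on generalizing X with
  | _ n ih =>
  cases n with
  | zero =>
    have h0 : ∀ k ∈ Finset.range K, k ≠ 0 →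
        xpow L (-(k : ℤ)) * X (PowerSeries.coeff k (1 : (Module.End ℂ (Fock L))⟦X⟧) q) = 0 := by
      intro k _ hk
      rw [PowerSeries.coeff_one, if_neg hk, LinearMap.zero_apply, map_zero, mul_zero]
    simp only [schur_zero, map_one, Finset.Nat.antidiagonal_zero, Finset.sum_singleton,
      minusShift_zero, plusShift_zero, compSeries, one_mul]
    rw [Finset.sum_eq_single 0 h0 fun h => absurd (Finset.mem_range.2 (by omega)) h]
    simp
  | succ n =>
    apply eq_of_smul_eq n.succ_ne_zero
    -- Since `normalOrder` is multiplicative, the current in the recursion for `s_γ` can be absorbed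
    -- into the field. The induction hypothesis is then needed for the new field, hence for all `X`.
    have h1 : (n + 1) • normalOrder B β (schur γ (n + 1)) X q =
        ∑ ij ∈ antidiagonal n,
          normalOrder B β (schur γ ij.2) (normalMul B β ij.1 (toCartan γ) X) q := by
      rw [← LinearMap.smul_apply, ← LinearMap.smul_apply, ← map_nsmul, ← Nat.cast_smul_eq_nsmul ℂ,
        succ_smul_schur, map_sum,
        LinearMap.sum_apply, LinearMap.sum_apply]
      refine Finset.sum_congr rfl fun ij _ => ?_
      rw [mul_comm, map_mul, normalOrder_creation, Module.End.mul_apply]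
    rw [Nat.succ_eq_add_one, Nat.cast_smul_eq_nsmul, Nat.cast_smul_eq_nsmul, h1, ← mul_smul_comm, succ_nsmul_sum_antidiagonal n
      (fun i => HahnSeries.ofPowerSeries ℤ (Fock L) (minusShift γ i))
      (fun j => compSeries K q X (plusShift B γ β j))]
    have h2 : ∀ ij ∈ antidiagonal n,
        normalOrder B β (schur γ ij.2) (normalMul B β ij.1 (toCartan γ) X) q =
        xpow L (-(n + 1 : ℕ)) * (∑ uv ∈ antidiagonal ij.2,
            HahnSeries.ofPowerSeries ℤ (Fock L) (minusCurrent γ ij.1 * minusShift γ uv.1) *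
              compSeries K q X (plusShift B γ β uv.2) +
          ∑ uv ∈ antidiagonal ij.2, HahnSeries.ofPowerSeries ℤ (Fock L) (minusShift γ uv.1) *
            compSeries K q X (plusCurrent B γ β ij.1 * plusShift B γ β uv.2)) := by
      intro ij hij
      have hij := mem_antidiagonal.1 hij
      rw [ih ij.2 (by omega), ← Finset.sum_add_distrib, Finset.mul_sum, Finset.mul_sum]
      refine Finset.sum_congr rfl fun uv _ => ?_
      rw [compSeries_normalMul β γ ij.1 X (isLowering_plusShift γ β uv.2) hq hK,
        show (-((n + 1 : ℕ) : ℤ)) = -(ij.2 : ℤ) + (-(ij.1 : ℤ) - 1) by rw [← hij]; push_cast; ring,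
        ← xpow_mul_xpow, map_mul]
      ring
    rw [Finset.sum_congr rfl h2, ← Finset.mul_sum, Finset.sum_add_distrib]
    -- The two summands are the `y`-derivatives of the left and of the right factor, by the
    -- recursions for `minusShift` and `plusShift`.
    congr 2
    · rw [← sum_antidiagonal_fst_assoc n fun i u v =>
        HahnSeries.ofPowerSeries ℤ (Fock L) (minusCurrent γ i * minusShift γ u) *
              compSeries K q X (plusShift B γ β v)]
      refine Finset.sum_congr rfl fun ij _ => ?_
      rw [← Finset.sum_mul, ← map_sum, ← succ_smul_minusShift, map_zsmul, natCast_zsmul]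
    · rw [sum_antidiagonal_snd_comm n fun i u v =>
        HahnSeries.ofPowerSeries ℤ (Fock L) (minusShift γ u) *
            compSeries K q X (plusCurrent B γ β i * plusShift B γ β v)]
      refine Finset.sum_congr rfl fun ij _ => ?_
      rw [← Finset.mul_sum, ← compSeries_sum, ← succ_smul_plusShift, compSeries_zsmul,
        natCast_zsmul]

/-! ### The integral form of the Fock space -/

variable (L) in
/-- The subring of `S(𝔥̂₋)` generated by the coefficients of all `E⁻(-γ, x)`, `γ ∈ L`. -/
def integralFock : Subring (Fock L) :=
  Subring.closure (Set.range fun x : L × ℕ => schur x.1 x.2)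

theorem schur_mem (γ : L) (n : ℕ) : schur γ n ∈ integralFock L :=
  Subring.subset_closure ⟨(γ, n), rfl⟩

theorem coeff_X_pow_mul_expMinus_mem (γ : L) (k n : ℕ) :
    PowerSeries.coeff n (PowerSeries.X ^ k * expMinus γ) ∈ integralFock L := by
  rw [PowerSeries.coeff_X_pow_mul']
  split_ifs
  · exact schur_mem γ _
  · exact zero_mem _

/-- By multiplicativity of `E⁺` it is enough to look at the generators `s_γ(n)`, where only integral
binomials occur. -/
theorem coeff_expPlus_mem (α : L) (k : ℕ) {q : Fock L} (hq : q ∈ integralFock L) :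
    PowerSeries.coeff k (expPlus B α) q ∈ integralFock L := by
  have hs : ∀ (γ : L) (k n : ℕ), PowerSeries.coeff k (expPlus B α) (schur γ n) ∈
      integralFock L := fun γ k n => by
    rw [coeff_expPlus_schur]
    exact zsmul_mem (coeff_X_pow_mul_expMinus_mem γ k n) _
  rw [integralFock] at hq
  induction hq using Subring.closure_induction generalizing k with
  | mem x hx =>
    obtain ⟨⟨γ, n⟩, rfl⟩ := hx
    exact hs γ k n
  | zero => rw [map_zero]; exact zero_mem _
  | one => rw [← schur_zero α]; exact hs α k 0
  | add x y _ _ hx hy => rw [map_add]; exact add_mem (hx k) (hy k)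
  | neg x _ hx => rw [map_neg]; exact neg_mem (hx k)
  | mul x y _ _ hx hy =>
    rw [coeff_expPlus_mul]
    exact sum_mem fun ij _ => mul_mem (hx ij.1) (hy ij.2)

theorem coeff_plusShift_mem (γ β : L) (n k : ℕ) {q : Fock L} (hq : q ∈ integralFock L) :
    PowerSeries.coeff k (plusShift B γ β n) q ∈ integralFock L := by
  rw [plusShift, PowerSeries.coeff_mul, LinearMap.sum_apply]
  refine sum_mem fun ij _ => ?_
  rw [Module.End.mul_apply, hasseSeries, PowerSeries.coeff_mk, LinearMap.smul_apply]
  exact zsmul_mem (coeff_expPlus_mem γ _ (coeff_expPlus_mem _ _ hq)) _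

theorem annihilation_mem {h : Cartan L} (hh : ∀ γ : L, ∃ z : ℤ, cform B h (toCartan γ) = z) (n : ℕ)
    {q : Fock L} (hq : q ∈ integralFock L) : annihilation B h (n + 1) q ∈ integralFock L := by
  have hA := hq
  rw [integralFock] at hq
  induction hq using Subring.closure_induction with
  | mem x hx =>
    obtain ⟨⟨γ, m⟩, rfl⟩ := hx
    obtain ⟨z, hz⟩ := hh γ
    rw [annihilation_schur, hz, Int.cast_smul_eq_zsmul]
    exact zsmul_mem (coeff_X_pow_mul_expMinus_mem γ _ _) _
  | zero => rw [map_zero]; exact zero_mem _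
  | one => rw [Derivation.map_one_eq_zero]; exact zero_mem _
  | add x y hx' hy' hx hy => rw [map_add]; exact add_mem (hx hx') (hy hy')
  | neg x hx' hx => rw [map_neg]; exact neg_mem (hx hx')
  | mul x y hx' hy' hx hy =>
    rw [Derivation.leibniz]
    exact add_mem (mul_mem hx' (hy hy')) (mul_mem hy' (hx hx'))

/-- The augmentation of `S(𝔥̂₋)` fixes constants and sends `s_γ(0)` to `1` and every other `s_γ(n)`
to `0`, so it maps `integralFock L` into `ℤ`. -/
theorem exists_int_of_algebraMap_mem {c : ℂ} (hc : algebraMap ℂ (Fock L) c ∈ integralFock L) :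
    ∃ z : ℤ, c = z := by
  have h : integralFock L ≤ (Int.castRingHom ℂ).range.comap
      (SymmetricAlgebra.algebraMapInv : Fock L →ₐ[ℂ] ℂ).toRingHom := by
    rw [integralFock, Subring.closure_le]
    rintro _ ⟨⟨γ, n⟩, rfl⟩
    cases n with
    | zero => simp only [schur_zero]; exact one_mem _
    | succ n =>
      have : (SymmetricAlgebra.algebraMapInv : Fock L →ₐ[ℂ] ℂ) (schur γ (n + 1)) = 0 := by
        apply eq_of_smul_eq n.succ_ne_zero
        rw [← map_smul, Nat.succ_eq_add_one, succ_smul_schur, map_sum, smul_zero]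
        refine Finset.sum_eq_zero fun ij _ => ?_
        rw [map_mul, creation, SymmetricAlgebra.algebraMapInv_ι, zero_mul]
      exact ⟨0, by simpa using this.symm⟩
  obtain ⟨z, hz⟩ := h hc
  refine ⟨z, ?_⟩
  simpa using hz.symm

/-! ### Fields preserving the integral form -/

variable (L) in
/-- The subring of Laurent series with coefficients in `integralFock L`. -/
def integralLaurent : Subring (LaurentSeries (Fock L)) where
  carrier := {f | ∀ k, f.coeff k ∈ integralFock L}
  mul_mem' {f g} hf hg k := by
    rw [HahnSeries.coeff_mul]
    exact sum_mem fun ij _ => mul_mem (hf _) (hg _)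
  one_mem' k := by
    rw [HahnSeries.coeff_one]
    split_ifs
    · exact one_mem _
    · exact zero_mem _
  add_mem' {f g} hf hg k := by
    rw [HahnSeries.coeff_add]
    exact add_mem (hf k) (hg k)
  zero_mem' k := by
    rw [HahnSeries.coeff_zero]
    exact zero_mem _
  neg_mem' {f} hf k := by
    rw [HahnSeries.coeff_neg]
    exact neg_mem (hf k)

theorem xpow_mem (k : ℤ) : xpow L k ∈ integralLaurent L := by
  intro j
  rw [HahnSeries.coeff_single]
  split_ifs
  · exact one_mem _
  · exact zero_mem _

theorem ofPowerSeries_mem {f : (Fock L)⟦X⟧} (hf : ∀ n, PowerSeries.coeff n f ∈ integralFock L) :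
    HahnSeries.ofPowerSeries ℤ (Fock L) f ∈ integralLaurent L := by
  intro k
  rw [PowerSeries.coeff_coe]
  split_ifs
  · exact zero_mem _
  · exact hf _

theorem coeff_minusShift_mem (γ : L) (n k : ℕ) :
    PowerSeries.coeff k (minusShift γ n) ∈ integralFock L := by
  rw [minusShift, PowerSeries.coeff_mul]
  refine sum_mem fun ij _ => mul_mem ?_ (schur_mem _ _)
  rw [hasseSeries, PowerSeries.coeff_mk]
  exact zsmul_mem (schur_mem _ _) _

/-- A field which maps `integralFock L` to Laurent series with coefficients in `integralFock L`. -/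
def IsIntegralField (X : Field L) : Prop :=
  ∀ q ∈ integralFock L, X q ∈ integralLaurent L

theorem isIntegralField_expField (α β : L) : IsIntegralField (expField B α β) := by
  intro q hq
  rw [expField, LinearMap.comp_apply, laurentMul_apply]
  refine mul_mem (mul_mem (xpow_mem _) (ofPowerSeries_mem fun n => schur_mem α n)) fun k => ?_
  rw [expPlusField, LinearMap.coe_mk, AddHom.coe_mk, HahnSeries.coeff_ofSuppBddBelow]
  split_ifs
  · exact coeff_expPlus_mem _ _ hq
  · exact zero_mem _

/-- Normal ordering is an algebra homomorphism in `p`, so generators suffice, and for these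
`normalOrder_schur_apply` has only integral ingredients. The field varies in the induction because a
product acts by successive normal ordering. -/
theorem IsIntegralField.normalOrder {X : Field L} (hX : IsIntegralField X) (β : L) {p : Fock L}
    (hp : p ∈ integralFock L) : IsIntegralField (normalOrder B β p X) := by
  rw [integralFock] at hp
  induction hp using Subring.closure_induction generalizing X with
  | mem x hx =>
    obtain ⟨⟨γ, n⟩, rfl⟩ := hx
    intro q hq
    obtain ⟨N, hN⟩ := exists_isBounded B q
    rw [normalOrder_schur_apply β γ n X hN N.lt_succ_self]
    refine mul_mem (xpow_mem _) (sum_mem fun ij _ =>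
      mul_mem (ofPowerSeries_mem (coeff_minusShift_mem γ ij.1)) (sum_mem fun k _ =>
        mul_mem (xpow_mem _) (hX _ (coeff_plusShift_mem γ β _ _ hq))))
  | zero => intro q _; rw [map_zero]; exact zero_mem _
  | one => rw [map_one]; exact hX
  | add x y _ _ hx hy => intro q hq; rw [map_add]; exact add_mem (hx hX q hq) (hy hX q hq)
  | neg x _ hx =>
    intro q hq
    have h : LatticeVertex.normalOrder B β (-x) X q + LatticeVertex.normalOrder B β x X q = 0 := by
      rw [← LinearMap.add_apply, ← LinearMap.add_apply, ← map_add, neg_add_cancel, map_zero]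
      rfl
    rw [eq_neg_of_add_eq_zero_left h]
    exact neg_mem (hx hX q hq)
  | mul x y _ _ hx hy => rw [map_mul]; exact hx (hy hX)

/-! ### The bound for `V_{L,ℤ}` -/

variable (L) in
/-- The vectors of `V_L` with all components in `integralFock L`. -/
def integralVectors : AddSubgroup (VL L) where
  carrier := {u | ∀ α, u α ∈ integralFock L}
  add_mem' hu hv α := add_mem (hu α) (hv α)
  zero_mem' _ := zero_mem _
  neg_mem' hu α := neg_mem (hu α)

theorem single_mem_integralVectors (α : L) {p : Fock L} (hp : p ∈ integralFock L) :
    (Finsupp.single α p : VL L) ∈ integralVectors L := by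
  classical
  intro β
  rw [Finsupp.single_apply]
  split_ifs
  · exact hp
  · exact zero_mem _

theorem isVertexSubring_integralVectors (ε : L → L → ℤˣ) :
    IsVertexSubring B ε (integralVectors L) where
  vacuum_mem := single_mem_integralVectors 0 (one_mem _)
  nthProduct_mem n {u v} hu hv := by
    refine sum_mem fun α _ => sum_mem fun β _ => single_mem_integralVectors _ ?_
    rw [Int.cast_smul_eq_zsmul]
    exact zsmul_mem ((isIntegralField_expField α β).normalOrder β (hu α) (v β) (hv β) _) _

theorem integralForm_le_integralVectors (ε : L → L → ℤˣ) :
    integralForm B ε ≤ integralVectors L :=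
  sInf_le ⟨isVertexSubring_integralVectors ε, fun α => single_mem_integralVectors α (one_mem _)⟩

/-! ### Quadratic vectors in `V_{L,ℤ}` -/

theorem expMinus_zero : expMinus (0 : L) = 1 := by
  ext n
  induction n using Nat.strong_induction_on with
  | _ n ih =>
  cases n with
  | zero => simp [expMinus, coeff_zero_formalExp]
  | succ n =>
    apply eq_of_smul_eq n.succ_ne_zero
    change ((n + 1 : ℕ) : ℂ) • schur (0 : L) (n + 1) = _
    rw [succ_smul_schur, PowerSeries.coeff_one, if_neg n.succ_ne_zero, smul_zero]
    refine Finset.sum_eq_zero fun ij _ => ?_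
    simp [creation, toCartan]

theorem coeff_succ_expPlus_one (α : L) (n : ℕ) :
    PowerSeries.coeff (n + 1) (expPlus B α) (1 : Fock L) = 0 := by
  have h : IsBounded B 0 (1 : Fock L) := by
    intro l hl
    rw [← map_one (algebraMap ℂ (Fock L))]
    exact foldl_const l hl 1
  exact expPlus_coeff_eq_zero α h n.succ_pos

theorem coeff_succ_expPlus_zero (n : ℕ) (q : Fock L) :
    PowerSeries.coeff (n + 1) (expPlus B 0) q = 0 := by
  apply eq_of_smul_eq n.succ_ne_zero
  rw [Nat.succ_eq_add_one, succ_smul_coeff_expPlus_apply, smul_zero, neg_eq_zero]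
  refine Finset.sum_eq_zero fun ij _ => ?_
  have : annihilation B (toCartan (0 : L)) (ij.1 + 1) = 0 := by
    rw [toCartan, TensorProduct.tmul_zero, ← zero_smul ℂ (0 : Cartan L), annihilation_smul, zero_smul]
  rw [this]
  rfl

theorem expPlusField_eq_single {α : L} {q : Fock L}
    (h : ∀ n, PowerSeries.coeff (n + 1) (expPlus B α) q = 0) :
    expPlusField B α q = HahnSeries.single 0 q := by
  ext k
  rw [expPlusField, LinearMap.coe_mk, AddHom.coe_mk, HahnSeries.coeff_ofSuppBddBelow,
    HahnSeries.coeff_single]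
  rcases lt_trichotomy k 0 with hk | rfl | hk
  · obtain ⟨n, hn⟩ := Nat.exists_eq_succ_of_ne_zero (show (-k).toNat ≠ 0 by omega)
    rw [if_pos hk.le, if_neg hk.ne, hn, Nat.succ_eq_add_one, h]
  · simp [coeff_zero_expPlus]
  · rw [if_neg (by omega), if_neg (by omega)]

theorem nthProduct_single (ε : L → L → ℤˣ) (n : ℤ) (α β : L) (p q : Fock L) :
    nthProduct B ε n (Finsupp.single α p) (Finsupp.single β q) =
      Finsupp.single (α + β) (((ε α β : ℤ) : ℂ) •
        (normalOrder B β p (expField B α β) q).coeff (-n - 1)) := by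
  rw [nthProduct, Finsupp.sum_single_index, Finsupp.sum_single_index]
  · simp
  · rw [Finsupp.sum_single_index] <;> simp

/-- As `E⁺` fixes `1`, `Y(ι(e_α), x) ι(e_{-α}) = ε(α, -α) x^{-⟨α,α⟩} E⁻(-α, x) 𝟏`, whose
coefficients are the vectors in question up to sign. -/
theorem single_schur_mem {ε : L → L → ℤˣ} {W : AddSubgroup (VL L)} (hW : IsVertexSubring B ε W)
    (he : ∀ α, expVector α ∈ W) (α : L) (n : ℕ) :
    (Finsupp.single 0 (schur α n) : VL L) ∈ W := by
  -- The product of index `m` is the coefficient of `x^{-m-1}`; this `m` selects the exponent `n -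
  -- ⟨α, α⟩`.
  have h := hW.nthProduct_mem (B α α - n - 1) (he α) (he (-α))
  have hc : (normalOrder B (-α) 1 (expField B α (-α)) 1).coeff (-(B α α - n - 1) - 1) =
      schur α n := by
    rw [map_one (normalOrder B (-α)), Module.End.one_apply, expField, LinearMap.comp_apply, laurentMul_apply,
      expPlusField_eq_single (coeff_succ_expPlus_one α), HahnSeries.single_zero_one, mul_one,
      show -(B α α - n - 1) - 1 = (n : ℤ) + B α (-α) by rw [map_neg]; ring,
      HahnSeries.coeff_single_mul_add, one_mul, LaurentSeries.coeff_coe_powerSeries]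
    rfl
  rw [expVector, expVector, nthProduct_single, hc, add_neg_cancel, Int.cast_smul_eq_zsmul] at h
  rcases Int.units_eq_one_or (ε α (-α)) with h1 | h1
  · simpa [h1] using h
  · rw [h1] at h
    simpa using h

theorem expField_zero (q : Fock L) : expField B 0 0 q = HahnSeries.single 0 q := by
  rw [expField, LinearMap.comp_apply, laurentMul_apply,
    expPlusField_eq_single fun n => coeff_succ_expPlus_zero n q, expMinus_zero]
  simp

/-- The vector is `(α(-1)𝟏)_{-1} (β(-1)𝟏)`, and both factors lie in `W` because `s_α(1) = α(-1)`. -/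
theorem single_creation_mul_creation_mem {ε : L → L → ℤˣ} (hε : IsCocycle B ε)
    {W : AddSubgroup (VL L)} (hW : IsVertexSubring B ε W) (he : ∀ α, expVector α ∈ W) (α β : L) :
    (Finsupp.single 0 (creation (toCartan α) 0 * creation (toCartan β) 0) : VL L) ∈ W := by
  have hα := single_schur_mem hW he α 1
  have hβ := single_schur_mem hW he β 1
  rw [schur_one] at hα hβ
  have h := hW.nthProduct_mem (-1) hα hβ
  rw [nthProduct_single, hε.zero_left, add_zero, normalOrder_creation] at h
  obtain ⟨N, hN⟩ := exists_isBounded B (creation (toCartan β) 0)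
  have h1 : normalMul B 0 0 (toCartan α) (expField B 0 0) (creation (toCartan β) 0) =
      HahnSeries.ofPowerSeries ℤ (Fock L) (currentMinus (toCartan α) 0) *
        expField B 0 0 (creation (toCartan β) 0) +
      rightMul B 0 (toCartan α) 0 (expField B 0 0) (creation (toCartan β) 0) := rfl
  -- The part `α(x)₊` contains only the powers `x^{-j-1}` with `j ≥ 0`, so it misses the constant
  -- term.
  have h2 : (rightMul B 0 (toCartan α) 0 (expField B 0 0) (creation (toCartan β) 0)).coeff 0 =
      0 := by
    rw [rightMul_apply _ _ _ _ hN, HahnSeries.coeff_sum]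
    refine Finset.sum_eq_zero fun j _ => ?_
    rw [rightTerm, expField_zero, HahnSeries.coeff_smul, HahnSeries.single_mul_single,
      HahnSeries.coeff_single_of_ne (by push_cast; omega), smul_zero]
  have h3 : (HahnSeries.ofPowerSeries ℤ (Fock L) (currentMinus (toCartan α) 0) *
      expField B 0 0 (creation (toCartan β) 0)).coeff 0 =
      creation (toCartan α) 0 * creation (toCartan β) 0 := by
    rw [expField_zero, HahnSeries.coeff_mul_single_zero]
    have := LaurentSeries.coeff_coe_powerSeries (currentMinus (toCartan α) 0) 0
    rw [Nat.cast_zero] at this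
    rw [this]
    simp [currentMinus]
  rw [show (- -1 - 1 : ℤ) = 0 by norm_num, h1, HahnSeries.coeff_add, h2, h3] at h
  simpa using h

end LatticeVertex

end

noncomputable section

/-! ### Dual bases -/

namespace LinearMap.BilinForm

variable {K V ι : Type*} [Field K] [AddCommGroup V] [Module K V] [Fintype ι] [DecidableEq ι]
  {G : LinearMap.BilinForm K V} (hG : G.Nondegenerate) (b : Basis ι K V)

theorem repr_eq_apply_dualBasis (y : V) (i : ι) : b.repr y i = G (G.dualBasis hG b i) y := by
  conv_rhs => rw [← b.sum_repr y, map_sum]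
  simp [apply_dualBasis_left]

theorem sum_apply_dualBasis_smul (y : V) : ∑ i, G (G.dualBasis hG b i) y • b i = y := by
  conv_rhs => rw [← b.sum_repr y]
  simp only [repr_eq_apply_dualBasis hG b]

theorem sum_apply_mul_apply_dualBasis (x y : V) :
    ∑ i, G x (b i) * G (G.dualBasis hG b i) y = G x y := by
  conv_rhs => rw [← sum_apply_dualBasis_smul hG b y, map_sum]
  exact Finset.sum_congr rfl fun i _ => by rw [map_smul, smul_eq_mul, mul_comm]

end LinearMap.BilinForm

/-- An even symmetric form takes its half integrally: the terms `(i, j)` and `(j, i)` coincide and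
the diagonal coefficients are even. `M` need not be closed under halving, so the factor `2` is
extracted before it is cancelled. -/
theorem AddSubgroup.inv_two_smul_sum_mem {V κ : Type*} [AddCommGroup V] [Module ℂ V]
    (M : AddSubgroup V) (n : κ → κ → ℤ) (hn : ∀ i j, n i j = n j i) (he : ∀ i, Even (n i i))
    (f : κ → κ → V) (hf : ∀ i j, f i j = f j i) (hM : ∀ i j, f i j ∈ M) (s : Finset κ) :
    (2⁻¹ : ℂ) • ∑ i ∈ s, ∑ j ∈ s, n i j • f i j ∈ M := by
  classical
  induction s using Finset.induction_on with
  | empty => simp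
  | insert a s ha ih =>
    obtain ⟨m, hm⟩ := he a
    have h1 : ∑ i ∈ insert a s, ∑ j ∈ insert a s, n i j • f i j =
        (∑ i ∈ s, ∑ j ∈ s, n i j • f i j) +
          (2 : ℂ) • (m • f a a + ∑ j ∈ s, n a j • f a j) := by
      have h2 : ∑ i ∈ s, n i a • f i a = ∑ i ∈ s, n a i • f a i :=
        Finset.sum_congr rfl fun i _ => by rw [hn, hf]
      simp only [Finset.sum_insert ha, Finset.sum_add_distrib, h2, hm, two_smul, add_smul]
      abel
    rw [h1, smul_add, smul_smul, inv_mul_cancel₀ two_ne_zero, one_smul]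
    exact M.add_mem ih (M.add_mem (M.zsmul_mem (hM _ _) _)
      (M.sum_mem fun j _ => M.zsmul_mem (hM _ _) _))

namespace LatticeVertex

variable {L : Type*} [AddCommGroup L] {B : LinearMap.BilinForm ℤ L}

/-! ### The dual lattice -/

theorem mem_dualSubmodule_latticeIn {x : Cartan L} :
    x ∈ (cform B).dualSubmodule (latticeIn L) ↔ ∀ γ : L, ∃ z : ℤ, cform B x (toCartan γ) = z := by
  rw [LinearMap.BilinForm.mem_dualSubmodule]
  constructor
  · intro h γ
    obtain ⟨z, hz⟩ := Submodule.mem_one.1 (h (toCartan γ) ⟨γ, rfl⟩)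
    exact ⟨z, by simpa using hz.symm⟩
  · rintro h _ ⟨γ, rfl⟩
    obtain ⟨z, hz⟩ := h γ
    exact Submodule.mem_one.2 ⟨z, by rw [eq_intCast]; exact hz.symm⟩

theorem latticeIn_le_dualSubmodule : latticeIn L ≤ (cform B).dualSubmodule (latticeIn L) := by
  rintro _ ⟨α, rfl⟩
  exact mem_dualSubmodule_latticeIn.2 fun γ => ⟨B α γ, cform_toCartan α γ⟩

theorem cform_isSymm (hsymm : B.IsSymm) : (cform B).IsSymm :=
  ⟨(LinearMap.BilinForm.IsSymm.baseChange ℂ (B₂ := B) ⟨hsymm.eq⟩).eq⟩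

theorem creation_sum_smul {κ : Type*} (s : Finset κ) (c : κ → ℂ) (h : κ → Cartan L) (n : ℕ) :
    creation (∑ k ∈ s, c k • h k) n = ∑ k ∈ s, c k • creation (h k) n := by
  simp only [creation, ← Finsupp.lsingle_apply (R := ℂ), map_sum, map_smul]

variable [Module.Free ℤ L] [Module.Finite ℤ L]

theorem dualBasis_baseChange_mem {κ : Type*} [Fintype κ] [DecidableEq κ] (hB : B.Nondegenerate)
    (a : Basis κ ℤ L) (k : κ) :
    (cform B).dualBasis (cform_nondegenerate hB) (a.baseChange ℂ) k ∈
      (cform B).dualSubmodule (latticeIn L) := by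
  refine mem_dualSubmodule_latticeIn.2 fun γ => ⟨a.repr γ k, ?_⟩
  rw [← LinearMap.BilinForm.repr_eq_apply_dualBasis, Basis.baseChange_repr_tmul]
  simp

/-- A lattice is self-dual as soon as the form is integral on its dual. -/
theorem isSelfDual_of_integral (hB : B.Nondegenerate)
    (h : ∀ x ∈ (cform B).dualSubmodule (latticeIn L),
      ∀ y ∈ (cform B).dualSubmodule (latticeIn L), ∃ z : ℤ, cform B x y = z) :
    IsSelfDual B := by
  classical
  refine le_antisymm (fun y hy => ?_) latticeIn_le_dualSubmodule
  let a := Module.Free.chooseBasis ℤ L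
  -- The coordinates of `y` in the basis `a` are its pairings with the dual basis; both lie in `L°`,
  -- so these are integers.
  choose z hz using fun k => h _ (dualBasis_baseChange_mem hB a k) y hy
  rw [← LinearMap.BilinForm.sum_apply_dualBasis_smul (cform_nondegenerate hB) (a.baseChange ℂ) y]
  refine Submodule.sum_mem _ fun k _ => ⟨z k • a k, ?_⟩
  rw [hz, Basis.baseChange_apply]
  change (1 : ℂ) ⊗ₜ[ℤ] (z k • a k) = _
  rw [TensorProduct.tmul_smul, Int.cast_smul_eq_zsmul]

/-! ### The conformal vector -/

section

variable {ι : Type*} [Fintype ι] [DecidableEq ι]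

/-- The two ways of contracting `x` and `y` with `b_i` and `b_i'` each sum to `⟨x, y⟩`, and the
factor `½` compensates for there being two. -/
theorem annihilation_annihilation_conformal (hsymm : B.IsSymm) (hB : B.Nondegenerate)
    (b : Basis ι ℂ (Cartan L)) (x y : Cartan L) :
    annihilation B x 1 (annihilation B y 1 (conformalVector hB b 0)) =
      algebraMap ℂ (Fock L) (cform B x y) := by
  have hG : (cform B).IsSymm := cform_isSymm hsymm
  have hc : ∀ x g : Cartan L, annihilation B x 1 (creation g 0) =
      algebraMap ℂ (Fock L) (cform B x g) := by
    intro x g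
    rw [← zero_add 1, annihilation_creation]
    simp
  have h1 := LinearMap.BilinForm.sum_apply_mul_apply_dualBasis (cform_nondegenerate hB) b x y
  have h2 := LinearMap.BilinForm.sum_apply_mul_apply_dualBasis (cform_nondegenerate hB) b y x
  rw [conformalVector, Finsupp.single_eq_same]
  simp only [Derivation.map_smul, map_sum, Derivation.leibniz, hc, smul_eq_mul, map_add,
    Derivation.map_algebraMap, mul_zero, zero_add, Finset.sum_add_distrib, ← map_mul]
  rw [← map_sum, ← map_sum, ← map_add, Algebra.smul_def, ← map_mul]
  congr 1
  have h3 : ∀ i, cform B ((cform B).dualBasis (cform_nondegenerate hB) b i) y =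
      cform B y ((cform B).dualBasis (cform_nondegenerate hB) b i) := fun i => hG.eq _ _
  have h4 : ∀ i, cform B ((cform B).dualBasis (cform_nondegenerate hB) b i) x =
      cform B x ((cform B).dualBasis (cform_nondegenerate hB) b i) := fun i => hG.eq _ _
  simp only [h3] at h1
  simp only [h4, hG.eq y x] at h2
  simp only [mul_comm (cform B y ((cform B).dualBasis (cform_nondegenerate hB) b _))]
  rw [h1, h2]
  ring

/-- The tensor `∑ b_i ⊗ b_i'` is inverse to the form and so independent of the basis; in the basis
`a` its matrix is the Gram matrix of the dual basis. -/
theorem sum_creation_mul_creation (hsymm : B.IsSymm) (hB : B.Nondegenerate)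
    (b : Basis ι ℂ (Cartan L)) {κ : Type*} [Fintype κ] [DecidableEq κ]
    (a : Basis κ ℂ (Cartan L)) :
    ∑ i, creation (b i) 0 *
        creation ((cform B).dualBasis (cform_nondegenerate hB) b i) 0 =
      ∑ k, ∑ l, cform B ((cform B).dualBasis (cform_nondegenerate hB) a k)
        ((cform B).dualBasis (cform_nondegenerate hB) a l) •
          (creation (a k) 0 * creation (a l) 0) := by
  have hG : (cform B).IsSymm := cform_isSymm hsymm
  have hGn := cform_nondegenerate hB
  have h1 : ∀ i, creation (b i) 0 * creation ((cform B).dualBasis hGn b i) 0 =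
      ∑ k, ∑ l, (cform B ((cform B).dualBasis hGn a k) (b i) *
        cform B ((cform B).dualBasis hGn b i) ((cform B).dualBasis hGn a l)) •
          (creation (a k) 0 * creation (a l) 0) := by
    intro i
    conv_lhs => rw [← LinearMap.BilinForm.sum_apply_dualBasis_smul hGn a (b i),
      ← LinearMap.BilinForm.sum_apply_dualBasis_smul hGn a ((cform B).dualBasis hGn b i),
      creation_sum_smul, creation_sum_smul, Finset.sum_mul_sum]
    refine Finset.sum_congr rfl fun k _ => Finset.sum_congr rfl fun l _ => ?_
    rw [smul_mul_smul_comm, hG.eq ((cform B).dualBasis hGn a l)]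
  rw [Finset.sum_congr rfl fun i _ => h1 i, Finset.sum_comm]
  refine Finset.sum_congr rfl fun k _ => ?_
  rw [Finset.sum_comm]
  refine Finset.sum_congr rfl fun l _ => ?_
  rw [← Finset.sum_smul, LinearMap.BilinForm.sum_apply_mul_apply_dualBasis]

theorem isSelfDual_of_conformalVector_mem (hsymm : B.IsSymm) (hB : B.Nondegenerate)
    {ε : L → L → ℤˣ} (b : Basis ι ℂ (Cartan L))
    (h : conformalVector hB b ∈ integralForm B ε) : IsSelfDual B := by
  refine isSelfDual_of_integral hB fun x hx y hy => exists_int_of_algebraMap_mem (L := L) ?_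
  rw [← annihilation_annihilation_conformal hsymm hB b]
  exact annihilation_mem (mem_dualSubmodule_latticeIn.1 hx) 0
    (annihilation_mem (mem_dualSubmodule_latticeIn.1 hy) 0 (integralForm_le_integralVectors ε h 0))

theorem conformalVector_mem_of_isSelfDual (hsymm : B.IsSymm) (hB : B.Nondegenerate)
    (heven : ∀ α, Even (B α α)) {ε : L → L → ℤˣ} (hε : IsCocycle B ε) (b : Basis ι ℂ (Cartan L))
    (h : IsSelfDual B) : conformalVector hB b ∈ integralForm B ε := by
  classical
  rw [integralForm, AddSubgroup.mem_sInf]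
  rintro W ⟨hW, he⟩
  let a := Module.Free.chooseBasis ℤ L
  -- Self-duality places the dual basis in `L`, so its Gram matrix is integral with even diagonal.
  have hd : ∀ k, ∃ δ : L, toCartan δ =
      (cform B).dualBasis (cform_nondegenerate hB) (a.baseChange ℂ) k := fun k => by
    have := dualBasis_baseChange_mem hB a k
    rw [show (cform B).dualSubmodule (latticeIn L) = latticeIn L from h] at this
    exact this
  choose δ hδ using hd
  have key := AddSubgroup.inv_two_smul_sum_mem (W.comap (Finsupp.singleAddHom (0 : L)))
    (fun k l => B (δ k) (δ l)) (fun k l => hsymm.eq _ _) (fun k => heven _)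
    (fun k l => creation (toCartan (a k)) 0 * creation (toCartan (a l)) 0)
    (fun k l => mul_comm _ _)
    (fun k l => single_creation_mul_creation_mem hε hW he (a k) (a l)) Finset.univ
  rw [conformalVector, sum_creation_mul_creation hsymm hB b (a.baseChange ℂ)]
  simp only [← hδ, cform_toCartan, Basis.baseChange_apply, Int.cast_smul_eq_zsmul]
  exact key

end

end LatticeVertex

end

theorem mainTheorem5 {L : Type*} [AddCommGroup L] [Module.Free ℤ L] [Module.Finite ℤ L]
    (B : LinearMap.BilinForm ℤ L) (hsymm : B.IsSymm) (hnd : B.Nondegenerate)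
    (heven : ∀ α, Even (B α α)) (ε : L → L → ℤˣ) (hε : LatticeVertex.IsCocycle B ε)
    {ι : Type*} [Fintype ι] [DecidableEq ι] (b : Module.Basis ι ℂ (LatticeVertex.Cartan L)) :
    LatticeVertex.conformalVector hnd b ∈ LatticeVertex.integralForm B ε ↔
      LatticeVertex.IsSelfDual B :=
  ⟨LatticeVertex.isSelfDual_of_conformalVector_mem hsymm hnd b,
    LatticeVertex.conformalVector_mem_of_isSelfDual hsymm hnd heven hε b⟩
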